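/- Let $A$ be a commutative Noetherian ring, $\mathfrak q\subseteq A$ an ideal, $G=\bigoplus_{n\ge 0}\mathfrak q^n/\mathfrak q^{n+1}$ the form ring of $A$ with respect to $\mathfrak q$, and $Q\subseteq G$ the homogeneous ideal generated by the initial forms of all elements of $\mathfrak q$. Let $x_1,\dots,x_m\in G_1=\mathfrak q/\mathfrak q^2$ be a system of generators of $Q$ consisting of forms of degree one. Let $H^i(Q;G)=H^i(x_1,\dots,x_m;G)$ denote the Koszul cohomology, graded so that the $i$-th term of the Koszul cochain complex is $G(i)^{\binom mi}$, and let $H^i_Q(G)$ denote the local cohomology of $G$ with support in $Q$ with its natural grading, computed as the cohomology of the Čech complex $0\to G\to\bigoplus_j G_{x_j}\to\bigoplus_{j<l}G_{x_jx_l}\to\cdots\to G_{x_1\cdots x_m}\to 0$. Let $f^i_G: H^i(Q;G)\to H^i_Q(G)$ be the canonical homomorphism, induced by the morphism from the Koszul complex to the Čech complex that sends the basis element $e_{j_1\cdots j_i}$ to $1/(x_{j_1}\cdots x_{j_i})$. For a graded $G$-module $M$ and $n\in\mathbb Z$ let $[M]_n$ be its $n$-th graded piece, and let $[f^i_G]_n$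 be the restriction of $f^i_G$ to the $n$-th graded pieces. Suppose that there is an integer $k$ such that $[H^i_Q(G)]_{k+1-i}=0$ for all $i\in\mathbb Z$. Then the homomorphism $$[f^i_G]_{k-i}:[H^i(Q;G)]_{k-i}\to[H^i_Q(G)]_{k-i}$$ is surjective for all $i\in\mathbb Z$. -/

import Mathlib

open scoped DirectSum

/-! ### The form ring -/

section FormRing

variable {A : Type*} [CommRing A]

/-- The `A`-module `𝔮ⁿ/𝔮ⁿ⁺¹`. -/
abbrev FormComponent (𝔮 : Ideal A) (n : ℕ) : Type _ :=
  ↥(𝔮 ^ n) ⧸ (𝔮 ^ (n + 1)).submoduleOf (𝔮 ^ n)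

namespace FormComponent

variable {𝔮 : Ideal A}

/-- The class in `𝔮ⁿ/𝔮ⁿ⁺¹` of an element `a ∈ 𝔮ⁿ`. -/
def cls (n : ℕ) (a : A) (ha : a ∈ 𝔮 ^ n) : FormComponent 𝔮 n :=
  Submodule.Quotient.mk ⟨a, ha⟩

theorem exists_cls {n : ℕ} (u : FormComponent 𝔮 n) : ∃ a ha, u = cls n a ha := by
  obtain ⟨⟨a, ha⟩, rfl⟩ := Submodule.Quotient.mk_surjective _ u
  exact ⟨a, ha, rfl⟩

theorem sigma_ext {n n' : ℕ} {a a' : A} (ha : a ∈ 𝔮 ^ n) (ha' : a' ∈ 𝔮 ^ n')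
    (hn : n = n') (h : a = a') :
    (⟨n, cls n a ha⟩ : GradedMonoid (FormComponent 𝔮)) = ⟨n', cls n' a' ha'⟩ := by
  subst hn; subst h; rfl

theorem mul_mem {i j : ℕ} {a b : A} (ha : a ∈ 𝔮 ^ i) (hb : b ∈ 𝔮 ^ j) : a * b ∈ 𝔮 ^ (i + j) := by
  rw [pow_add]; exact Ideal.mul_mem_mul ha hb

/-- The multiplication `𝔮ⁱ × 𝔮ʲ → 𝔮ⁱ⁺ʲ/𝔮ⁱ⁺ʲ⁺¹`. -/
def preMul (𝔮 : Ideal A) (i j : ℕ) :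
    ↥(𝔮 ^ i) →ₗ[A] ↥(𝔮 ^ j) →ₗ[A] FormComponent 𝔮 (i + j) :=
  LinearMap.mk₂ A (fun a b => cls (i + j) ((a : A) * b) (mul_mem a.2 b.2))
    (fun a a' b => by
      simp only [cls, ← Submodule.Quotient.mk_add]
      congr 1; ext; simp [add_mul])
    (fun c a b => by
      simp only [cls, ← Submodule.Quotient.mk_smul]
      congr 1; ext; simp [mul_assoc])
    (fun a b b' => by
      simp only [cls, ← Submodule.Quotient.mk_add]
      congr 1; ext; simp [mul_add])
    (fun c a b => by
      simp only [cls, ← Submodule.Quotient.mk_smul]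
      congr 1; ext; simp [mul_left_comm])

/-- The multiplication `𝔮ⁱ/𝔮ⁱ⁺¹ × 𝔮ʲ/𝔮ʲ⁺¹ → 𝔮ⁱ⁺ʲ/𝔮ⁱ⁺ʲ⁺¹` induced by that of `A`. -/
def mul (𝔮 : Ideal A) (i j : ℕ) :
    FormComponent 𝔮 i →ₗ[A] FormComponent 𝔮 j →ₗ[A] FormComponent 𝔮 (i + j) :=
  Submodule.liftQ _
    (LinearMap.flip (Submodule.liftQ _ (preMul 𝔮 i j).flip (by
      intro b hb
      rw [LinearMap.mem_ker]
      ext a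
      refine (Submodule.Quotient.mk_eq_zero _).2 ?_
      have hb' : (b : A) ∈ 𝔮 ^ (j + 1) := hb
      exact mul_mem a.2 hb')))
    (by
      intro a ha
      rw [LinearMap.mem_ker]
      ext b
      refine (Submodule.Quotient.mk_eq_zero _).2 ?_
      have ha' : (a : A) ∈ 𝔮 ^ (i + 1) := ha
      have := mul_mem ha' b.2
      change (a : A) * b ∈ 𝔮 ^ (i + j + 1)
      rwa [add_right_comm] at this)

theorem mul_cls {i j : ℕ} {a b : A} (ha : a ∈ 𝔮 ^ i) (hb : b ∈ 𝔮 ^ j) :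
    mul 𝔮 i j (cls i a ha) (cls j b hb) = cls (i + j) (a * b) (mul_mem ha hb) := rfl

instance instGOne (𝔮 : Ideal A) : GradedMonoid.GOne (FormComponent 𝔮) where
  one := cls 0 1 (by simp)

instance instGMul (𝔮 : Ideal A) : GradedMonoid.GMul (FormComponent 𝔮) where
  mul {i j} u v := mul 𝔮 i j u v

instance instGCommRing (𝔮 : Ideal A) : DirectSum.GCommRing (FormComponent 𝔮) where
  mul_zero _ := map_zero _
  zero_mul v := LinearMap.congr_fun (map_zero (mul 𝔮 _ _)) v
  mul_add _ _ _ := map_add _ _ _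
  add_mul u u' v := LinearMap.congr_fun (map_add (mul 𝔮 _ _) u u') v
  one_mul := by
    rintro ⟨n, u⟩
    obtain ⟨a, ha, rfl⟩ := exists_cls u
    exact sigma_ext _ _ (zero_add n) (one_mul a)
  mul_one := by
    rintro ⟨n, u⟩
    obtain ⟨a, ha, rfl⟩ := exists_cls u
    exact sigma_ext _ _ (add_zero n) (mul_one a)
  mul_assoc := by
    rintro ⟨n, u⟩ ⟨n', u'⟩ ⟨n'', u''⟩
    obtain ⟨a, ha, rfl⟩ := exists_cls u
    obtain ⟨a', ha', rfl⟩ := exists_cls u'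
    obtain ⟨a'', ha'', rfl⟩ := exists_cls u''
    exact sigma_ext _ _ (add_assoc n n' n'') (mul_assoc a a' a'')
  mul_comm := by
    rintro ⟨n, u⟩ ⟨n', u'⟩
    obtain ⟨a, ha, rfl⟩ := exists_cls u
    obtain ⟨a', ha', rfl⟩ := exists_cls u'
    exact sigma_ext _ _ (add_comm n n') (mul_comm a a')
  natCast r := cls 0 (r : A) (by simp)
  natCast_zero := by
    refine (Submodule.Quotient.mk_eq_zero _).2 ?_
    simp [Submodule.submoduleOf]
  natCast_succ r := by
    simp only [cls, Nat.cast_succ]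
    rfl
  intCast r := cls 0 (r : A) (by simp)
  intCast_ofNat r := by simp
  intCast_negSucc_ofNat r := by
    simp only [cls, Int.cast_negSucc]
    rfl

end FormComponent

/-- The form ring `G = ⨁ₙ 𝔮ⁿ/𝔮ⁿ⁺¹` of `A` with respect to `𝔮`. -/
abbrev FormRing (𝔮 : Ideal A) : Type _ := ⨁ n : ℕ, FormComponent 𝔮 n

namespace FormRing

/-- The `n`-th graded piece of the form ring, `n ∈ ℤ`: the elements whose only
nonzero component has degree `n` (so it is zero for `n < 0`). -/
def piece (𝔮 : Ideal A) (n : ℤ) : AddSubgroup (FormRing 𝔮) where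
  carrier := {g | ∀ l : ℕ, (l : ℤ) ≠ n → g l = 0}
  zero_mem' := fun _ _ => rfl
  add_mem' := fun {a b} ha hb l hl => by
    rw [DirectSum.add_apply, ha l hl, hb l hl, add_zero]
  neg_mem' := fun {a} ha l hl => by
    have : (-a) l = -(a l) := rfl
    rw [this, ha l hl, neg_zero]

/-- The homogeneous ideal `Q` of the form ring generated by the initial forms of all
elements of `𝔮`; the initial form of `a ∈ 𝔮ⁿ`, `a ∉ 𝔮ⁿ⁺¹`, is its class in `𝔮ⁿ/𝔮ⁿ⁺¹`. -/
def initialIdeal (𝔮 : Ideal A) : Ideal (FormRing 𝔮) :=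
  Ideal.span {g | ∃ (n : ℕ) (a : A) (ha : a ∈ 𝔮 ^ n), a ∈ 𝔮 ∧ a ∉ 𝔮 ^ (n + 1) ∧
    g = DirectSum.of (FormComponent 𝔮) n (FormComponent.cls n a ha)}

end FormRing

end FormRing

/-! ### Cochain complexes indexed by the subsets of `{1, …, m}` -/

section Cube

variable {R : Type*} [CommRing R] {m : ℕ}

/-- The differential on `⨁_I M I`, for `I` running through the subsets of `{1, …, m}`:
`(d c)_J = ∑_{j ∈ J} (-1)^{#{l ∈ J | l < j}} ρ(c_{J ∖ {j}})`, where `ρ : M I → M J`, `I ⊆ J`,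
are given transition maps. -/
def cubeD (M : Finset (Fin m) → Type*) [∀ I, AddCommGroup (M I)] [∀ I, Module R (M I)]
    (ρ : ∀ ⦃I J : Finset (Fin m)⦄, I ⊆ J → (M I →ₗ[R] M J)) :
    (∀ I, M I) →ₗ[R] (∀ I, M I) :=
  LinearMap.pi fun J => ∑ j ∈ J, (-1 : ℤ) ^ (J.filter (· < j)).card •
    (ρ (J.erase_subset j) ∘ₗ LinearMap.proj (J.erase j))

/-- The cochains of cohomological degree `i ∈ ℤ`: `⨁_{#I = i} M I`. -/
def cubeDeg (R : Type*) [CommRing R] {m : ℕ} (M : Finset (Fin m) → Type*)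
    [∀ I, AddCommGroup (M I)] [∀ I, Module R (M I)] (i : ℤ) : Submodule R (∀ I, M I) where
  carrier := {c | ∀ I, (I.card : ℤ) ≠ i → c I = 0}
  zero_mem' := fun _ _ => rfl
  add_mem' := fun {a b} ha hb I hI => by rw [Pi.add_apply, ha I hI, hb I hI, add_zero]
  smul_mem' := fun r a ha I hI => by rw [Pi.smul_apply, ha I hI, smul_zero]

end Cube

section Cohomology

variable {R : Type*} [CommRing R]

/-- The cohomology at `C i` of the complex `⋯ → C (i-1) → C i → C (i+1) → ⋯` of submodules
`C i` of a module `M` with differential `d : M → M`. -/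
abbrev Cohomology {M : Type*} [AddCommGroup M] [Module R M] (d : M →ₗ[R] M)
    (C : ℤ → Submodule R M) (i : ℤ) : Type _ :=
  ↥(C i ⊓ LinearMap.ker d) ⧸ ((C (i - 1)).map d).submoduleOf (C i ⊓ LinearMap.ker d)

/-- The classes of the cocycles that lie in `P`; for `P` the homogeneous elements of degree `n`
of a graded complex this is the `n`-th graded piece of the cohomology. -/
def Cohomology.piece {M : Type*} [AddCommGroup M] [Module R M] (d : M →ₗ[R] M)
    (C : ℤ → Submodule R M) (i : ℤ) (P : AddSubgroup M) : AddSubgroup (Cohomology d C i) :=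
  (P.comap (C i ⊓ LinearMap.ker d).subtype.toAddMonoidHom).map
    (Submodule.mkQ _).toAddMonoidHom

/-- The map induced in cohomology by a morphism of complexes. -/
def Cohomology.map {M N : Type*} [AddCommGroup M] [Module R M] [AddCommGroup N] [Module R N]
    {d : M →ₗ[R] M} {C : ℤ → Submodule R M} {e : N →ₗ[R] N} {D : ℤ → Submodule R N}
    (φ : M →ₗ[R] N) (hφ : ∀ c, φ (d c) = e (φ c)) (hC : ∀ i, ∀ c ∈ C i, φ c ∈ D i) (i : ℤ) :
    Cohomology d C i →ₗ[R] Cohomology e D i :=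
  Submodule.mapQ _ _
    (φ.restrict fun c hc => ⟨hC i c hc.1, by
      have h : d c = 0 := hc.2
      change e (φ c) = 0
      rw [← hφ, h, map_zero]⟩)
    (by
      rintro ⟨c, hc⟩ ⟨b, hb, hbc⟩
      exact ⟨φ b, hC _ b hb, by rw [← hφ, hbc]; rfl⟩)

theorem Cohomology.map_mem_piece {M N : Type*} [AddCommGroup M] [Module R M] [AddCommGroup N]
    [Module R N] {d : M →ₗ[R] M} {C : ℤ → Submodule R M} {e : N →ₗ[R] N}
    {D : ℤ → Submodule R N} (φ : M →ₗ[R] N) (hφ : ∀ c, φ (d c) = e (φ c))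
    (hC : ∀ i, ∀ c ∈ C i, φ c ∈ D i) (i : ℤ) {P : AddSubgroup M} {P' : AddSubgroup N}
    (hP : ∀ c ∈ P, φ c ∈ P') {z : Cohomology d C i} (hz : z ∈ piece d C i P) :
    map φ hφ hC i z ∈ piece e D i P' := by
  obtain ⟨c, hc, rfl⟩ := hz
  exact ⟨_, hP _ hc, rfl⟩

end Cohomology

/-! ### Koszul cohomology, local cohomology and the canonical map -/

noncomputable section Koszul

variable {R : Type*} [CommRing R] {m : ℕ}

/-- The product `x_I` of the `x j`, `j ∈ I`. -/
abbrev subProd (x : Fin m → R) (I : Finset (Fin m)) : R := ∏ j ∈ I, x j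

/-- The modules `R e_I` of the Koszul complex. -/
abbrev KoszulTerm (R : Type*) (m : ℕ) (_I : Finset (Fin m)) : Type _ := R

/-- The differential of the Koszul cochain complex `K^•(x; R)`,
`(d g)_J = ∑_{j ∈ J} (-1)^{#{l ∈ J | l < j}} x_j g_{J ∖ {j}}`. -/
def koszulD (x : Fin m → R) : (∀ I, KoszulTerm R m I) →ₗ[R] (∀ I, KoszulTerm R m I) :=
  cubeD (KoszulTerm R m) fun I J _ => LinearMap.lsmul R R (subProd x (J \ I))

/-- The Koszul cohomology `H^i(x; R)`. -/
abbrev KoszulCohomology (x : Fin m → R) (i : ℤ) : Type _ :=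
  Cohomology (koszulD x) (cubeDeg R (KoszulTerm R m)) i

/-- The homogeneous elements of degree `n` of the Koszul complex of elements of degree one:
`e_I` has degree `-#I`, so that `K^i(x; R) = R(i)^{binom(m, i)}`. -/
def koszulHomog (𝒢 : ℤ → AddSubgroup R) (m : ℕ) (n : ℤ) :
    AddSubgroup (∀ I, KoszulTerm R m I) where
  carrier := {g | ∀ I, g I ∈ 𝒢 (n + I.card)}
  zero_mem' := fun _ => zero_mem _
  add_mem' := fun ha hb I => add_mem (ha I) (hb I)
  neg_mem' := fun ha I => neg_mem (ha I)

/-- The graded piece `[H^i(x; R)]_n` (`𝒢` is the grading of `R`, the `x j` have degree one). -/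
abbrev KoszulCohomology.piece (𝒢 : ℤ → AddSubgroup R) (x : Fin m → R) (i n : ℤ) :
    AddSubgroup (KoszulCohomology x i) :=
  Cohomology.piece (koszulD x) (cubeDeg R (KoszulTerm R m)) i (koszulHomog 𝒢 m n)

/-- The localization `R_{x_I}`. -/
abbrev CechTerm (x : Fin m → R) (I : Finset (Fin m)) : Type _ :=
  Localization.Away (subProd x I)

/-- The fraction `a / x_I ^ t`. -/
def cechFrac (x : Fin m → R) (I : Finset (Fin m)) (a : R) (t : ℕ) : CechTerm x I :=
  Localization.mk a (⟨subProd x I ^ t, t, rfl⟩ : Submonoid.powers (subProd x I))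

theorem isUnit_subProd (x : Fin m → R) {I J : Finset (Fin m)} (h : I ⊆ J) :
    IsUnit (algebraMap R (CechTerm x J) (subProd x I)) :=
  isUnit_of_dvd_unit (map_dvd _ (Finset.prod_dvd_prod_of_subset _ _ _ h))
    (IsLocalization.Away.algebraMap_isUnit (subProd x J))

/-- The canonical map `R_{x_I} → R_{x_J}` for `I ⊆ J`. -/
def cechRestrict (x : Fin m → R) ⦃I J : Finset (Fin m)⦄ (h : I ⊆ J) :
    CechTerm x I →ₐ[R] CechTerm x J :=
  IsLocalization.liftAlgHom (M := Submonoid.powers (subProd x I)) (f := Algebra.ofId R _) (by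
    rintro ⟨_, t, rfl⟩
    change IsUnit (algebraMap R (CechTerm x J) (subProd x I ^ t))
    rw [map_pow]
    exact (isUnit_subProd x h).pow t)

/-- The differential of the (extended) Čech complex
`0 → R → ⨁_j R_{x_j} → ⨁_{j<l} R_{x_j x_l} → ⋯ → R_{x_1 ⋯ x_m} → 0`. -/
def cechD (x : Fin m → R) : (∀ I, CechTerm x I) →ₗ[R] (∀ I, CechTerm x I) :=
  cubeD (CechTerm x) fun _ _ h => (cechRestrict x h).toLinearMap

/-- The local cohomology `H^i_Q(R)` of a Noetherian ring `R` with support in the ideal `Q`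
generated by `x 1, …, x m`, as the cohomology of the Čech complex. -/
abbrev CechLocalCohomology (x : Fin m → R) (i : ℤ) : Type _ :=
  Cohomology (cechD x) (cubeDeg R (CechTerm x)) i

/-- The homogeneous elements of degree `n` of the Čech complex of elements of degree one: on
`R_{x_I}` they are the sums of fractions `g / x_I ^ t` with `g` homogeneous of
degree `n + t * #I`. -/
def cechHomog (𝒢 : ℤ → AddSubgroup R) (x : Fin m → R) (n : ℤ) :
    AddSubgroup (∀ I, CechTerm x I) where
  carrier := {c | ∀ I, c I ∈ AddSubgroup.closure
    {y : CechTerm x I | ∃ (t : ℕ) (g : R), g ∈ 𝒢 (n + t * I.card) ∧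
      y = cechFrac x I g t}}
  zero_mem' := fun _ => zero_mem _
  add_mem' := fun ha hb I => add_mem (ha I) (hb I)
  neg_mem' := fun ha I => neg_mem (ha I)

/-- The graded piece `[H^i_Q(R)]_n` (`𝒢` is the grading of `R`, the `x j` have degree one). -/
abbrev CechLocalCohomology.piece (𝒢 : ℤ → AddSubgroup R) (x : Fin m → R) (i n : ℤ) :
    AddSubgroup (CechLocalCohomology x i) :=
  Cohomology.piece (cechD x) (cubeDeg R (CechTerm x)) i (cechHomog 𝒢 x n)

/-- The canonical morphism from the Koszul complex to the Čech complex, `e_I ↦ 1 / x_I`. -/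
def koszulToCech (x : Fin m → R) : (∀ I, KoszulTerm R m I) →ₗ[R] (∀ I, CechTerm x I) :=
  LinearMap.pi fun I =>
    (LinearMap.toSpanSingleton R (CechTerm x I)
      (cechFrac x I 1 1)) ∘ₗ LinearMap.proj I

theorem cechFrac_eq_smul (x : Fin m → R) (I : Finset (Fin m)) (a : R) :
    LinearMap.toSpanSingleton R (CechTerm x I) (cechFrac x I 1 1) a = cechFrac x I a 1 := by
  simp [cechFrac, Localization.smul_mk]

theorem koszulToCech_apply (x : Fin m → R) (g : ∀ I, KoszulTerm R m I) (I : Finset (Fin m)) :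
    koszulToCech x g I = cechFrac x I (g I) 1 :=
  cechFrac_eq_smul x I (g I)

theorem algebraMap_mul_cechFrac (x : Fin m → R) (I : Finset (Fin m)) (a : R) :
    algebraMap R (CechTerm x I) (subProd x I) * cechFrac x I a 1 = algebraMap R _ a := by
  rw [cechFrac, ← Localization.mk_one_eq_algebraMap, ← Localization.mk_one_eq_algebraMap,
    Localization.mk_mul, Localization.mk_eq_mk_iff, Localization.r_iff_exists]
  exact ⟨1, by simp [mul_comm]⟩

theorem cechRestrict_frac (x : Fin m → R) {J : Finset (Fin m)} {j : Fin m} (hj : j ∈ J) (a : R) :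
    cechRestrict x (J.erase_subset j) (cechFrac x (J.erase j) a 1) =
      cechFrac x J (x j * a) 1 := by
  refine (isUnit_subProd x (subset_refl J)).mul_left_cancel ?_
  rw [algebraMap_mul_cechFrac]
  have h : subProd x J = x j * subProd x (J.erase j) := (Finset.mul_prod_erase J x hj).symm
  have h' : algebraMap R (CechTerm x J) (subProd x J) =
      algebraMap R _ (x j) * algebraMap R _ (subProd x (J.erase j)) := by
    rw [← map_mul, ← h]
  rw [h', map_mul, mul_assoc]
  congr 1
  rw [← AlgHom.commutes (cechRestrict x (J.erase_subset j)), ← map_mul,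
    algebraMap_mul_cechFrac, AlgHom.commutes]

theorem koszulToCech_comm (x : Fin m → R) (g : ∀ I, KoszulTerm R m I) :
    koszulToCech x (koszulD x g) = cechD x (koszulToCech x g) := by
  funext J
  rw [koszulToCech_apply, ← cechFrac_eq_smul]
  simp only [koszulD, cechD, cubeD, LinearMap.pi_apply, LinearMap.sum_apply, map_sum,
    LinearMap.smul_apply, map_zsmul, LinearMap.comp_apply, LinearMap.proj_apply,
    AlgHom.toLinearMap_apply]
  refine Finset.sum_congr rfl fun j hj => ?_
  have hs : J \ J.erase j = {j} := by
    rw [Finset.sdiff_erase hj]; simp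
  rw [koszulToCech_apply, cechRestrict_frac x hj, cechFrac_eq_smul, LinearMap.lsmul_apply,
    smul_eq_mul, hs]
  simp [subProd]

theorem koszulToCech_deg (x : Fin m → R) (i : ℤ) (g : ∀ I, KoszulTerm R m I)
    (hg : g ∈ cubeDeg R (KoszulTerm R m) i) : koszulToCech x g ∈ cubeDeg R (CechTerm x) i := by
  intro I hI
  rw [koszulToCech_apply, hg I hI, cechFrac, Localization.mk_zero]

theorem koszulToCech_homog (𝒢 : ℤ → AddSubgroup R) (x : Fin m → R) (n : ℤ)
    (g : ∀ I, KoszulTerm R m I) (hg : g ∈ koszulHomog 𝒢 m n) :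
    koszulToCech x g ∈ cechHomog 𝒢 x n := by
  intro I
  refine AddSubgroup.subset_closure ⟨1, g I, by simpa using hg I, koszulToCech_apply x g I⟩

/-- The canonical homomorphism `f^i : H^i(x; R) → H^i_Q(R)`. -/
def canonicalMap (x : Fin m → R) (i : ℤ) : KoszulCohomology x i →ₗ[R] CechLocalCohomology x i :=
  Cohomology.map (koszulToCech x) (koszulToCech_comm x) (koszulToCech_deg x) i

/-- The graded piece `[f^i]_n : [H^i(x; R)]_n → [H^i_Q(R)]_n`. -/
def canonicalMapPiece (𝒢 : ℤ → AddSubgroup R) (x : Fin m → R) (i n : ℤ) :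
    KoszulCohomology.piece 𝒢 x i n →+ CechLocalCohomology.piece 𝒢 x i n :=
  ((canonicalMap x i).toAddMonoidHom.comp (AddSubgroup.subtype _)).codRestrict _
    fun z => Cohomology.map_mem_piece _ (koszulToCech_comm x) (koszulToCech_deg x) i
      (koszulToCech_homog 𝒢 x n) z.2

end Koszul

/-!
The Čech complex and the Koszul complex of `x_1, …, x_m` are tensor products over `j` of the
two-term complexes `C(x_j) = (R → R_{x_j})` and `K(x_j) = (R → R)`, the second map being
multiplication by `x_j`; the canonical morphism is the tensor product of the maps
`K(x_j) → C(x_j)` that divide by `x_j` in cohomological degree one. Replacing one factor at a time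
gives, for `S ⊆ {1, …, m}`, a mixed complex with factors `K(x_j)` for `j ∈ S` and `C(x_j)` for
`j ∉ S`. It is a cube complex with component `R_{x_{I ∖ S}}` at `I`, and it is enough to compare
`S` with `S ∪ {j}`.

Let `U` be the mixed complex of the other directions and `V = U_{x_j}`. The two complexes are the
fibres of the localization `U → V` and of multiplication by `x_j` on `U`. Suppose that the first
has no cohomology in the bidegrees `(i, k + 1 - i)`. A cocycle `(u, v)` of bidegree `(i, k - i)`
becomes one of bidegree `(i, k + 1 - i)` after multiplication by `x_j`, so
`(x_j u, x_j v) = d(u', v')`; this says that `(u, u')` is a cocycle of the second fibre, and that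
its image `(u, u' / x_j)` differs from `(u, v)` by the coboundary of `(0, v' / x_j)` up to sign
(`ExactOnDiagonal.exists_fibre_smul`). The same kind of chase, used twice, shows that the second
fibre has no cohomology in the bidegrees `(i, k + 1 - i)` either (`ExactOnDiagonal.fibre_smul`).
Induction on `S` gives the surjectivity (`exists_mixD_cocycle`).

Only the bijectivity of `x_j` on `V` and the degrees matter, so the induction is carried out for
the abstract families of modules `GradedCube`. The chase needs homogeneous coboundaries; these come
from the projections of `R_{x_I}` onto its graded pieces, which are read off from a coaction
`R_{x_I} → R_{x_I}[T;T⁻¹]` that extends `r ↦ ∑ₙ rₙ Tⁿ`. The argument works over any `ℤ`-graded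
commutative ring with forms `x_j` of degree one (`canonicalMapPiece_surjective`).
-/

/-! ### The grading of the localizations in the Čech complex -/

noncomputable section CechGrading

open LaurentPolynomial

variable {R : Type*} [CommRing R] {m : ℕ}

theorem cechRestrict_self (x : Fin m → R) {I : Finset (Fin m)} (h : I ⊆ I) (y : CechTerm x I) :
    cechRestrict x h y = y :=
  have := IsLocalization.algHom_subsingleton (R := R) (S := CechTerm x I) (P := CechTerm x I)
    (Submonoid.powers (subProd x I))
  DFunLike.congr_fun (Subsingleton.elim (cechRestrict x h) (AlgHom.id R _)) y

theorem cechRestrict_trans (x : Fin m → R) {I J K : Finset (Fin m)} (h : I ⊆ J) (h' : J ⊆ K)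
    (y : CechTerm x I) :
    cechRestrict x h' (cechRestrict x h y) = cechRestrict x (h.trans h') y :=
  have := IsLocalization.algHom_subsingleton (R := R) (S := CechTerm x I) (P := CechTerm x K)
    (Submonoid.powers (subProd x I))
  DFunLike.congr_fun
    (Subsingleton.elim ((cechRestrict x h').comp (cechRestrict x h))
      (cechRestrict x (h.trans h'))) y

/-- Multiplication by `x_K` is bijective on `R_{x_I}` when `K ⊆ I`. -/
theorem smul_subProd_bijective (x : Fin m → R) {K I : Finset (Fin m)} (h : K ⊆ I) :
    Function.Bijective fun y : CechTerm x I => subProd x K • y := by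
  simp only [Algebra.smul_def]
  exact IsUnit.isUnit_iff_mulLeft_bijective.1 (isUnit_subProd x h)

theorem cechFrac_spec (x : Fin m → R) (I : Finset (Fin m)) (a : R) (t : ℕ) :
    cechFrac x I a t * algebraMap R _ (subProd x I) ^ t = algebraMap R _ a := by
  rw [← map_pow, cechFrac, ← Localization.mk_one_eq_algebraMap,
    ← Localization.mk_one_eq_algebraMap, Localization.mk_mul, Localization.mk_eq_mk_iff,
    Localization.r_iff_exists]
  exact ⟨1, by simp [mul_comm]⟩

theorem cechFrac_add (x : Fin m → R) (I : Finset (Fin m)) (a b : R) (t : ℕ) :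
    cechFrac x I (a + b) t = cechFrac x I a t + cechFrac x I b t := by
  refine ((isUnit_subProd x (subset_refl I)).pow t).mul_right_cancel ?_
  rw [add_mul, cechFrac_spec, cechFrac_spec, cechFrac_spec, map_add]

theorem exists_cechFrac (x : Fin m → R) (I : Finset (Fin m)) (y : CechTerm x I) :
    ∃ a t, y = cechFrac x I a t := by
  induction y using Localization.induction_on with
  | H y =>
    obtain ⟨a, _, t, rfl⟩ := y
    exact ⟨a, t, rfl⟩

variable (𝒢 : ℤ → AddSubgroup R)

/-- The homogeneous elements of degree `n` of the localization `R_{x_I}`. -/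
def cechPiece (x : Fin m → R) (I : Finset (Fin m)) (n : ℤ) : AddSubgroup (CechTerm x I) :=
  AddSubgroup.closure
    {y : CechTerm x I | ∃ (t : ℕ) (g : R), g ∈ 𝒢 (n + t * I.card) ∧ y = cechFrac x I g t}

theorem coeff_C_mul_T {S : Type*} [CommRing S] (s : S) (n l : ℤ) :
    (C s * T n : S[T;T⁻¹]).coeff l = if n = l then s else 0 := by
  rw [← single_eq_C_mul_T, AddMonoidAlgebra.coeff_single, Finsupp.single_apply]

theorem mapRingHom_C_mul_T {S S' : Type*} [CommRing S] [CommRing S'] (f : S →+* S') (s : S)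
    (n : ℤ) : AddMonoidAlgebra.mapRingHom ℤ f (C s * T n) = C (f s) * T n := by
  ext l
  rw [AddMonoidAlgebra.coeff_mapRingHom, coeff_C_mul_T, coeff_C_mul_T, apply_ite f, map_zero]

/-- For `I = ∅` the graded ring `R_{x_I}` is `R`. -/
theorem exists_algebraMap_of_mem {𝒢 : ℤ → AddSubgroup R} {x : Fin m → R}
    {I : Finset (Fin m)} (hI : I = ∅) {n : ℤ} {y : CechTerm x I}
    (hy : y ∈ cechPiece 𝒢 x I n) : ∃ r ∈ 𝒢 n, algebraMap R (CechTerm x I) r = y := by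
  subst hI
  induction hy using AddSubgroup.closure_induction with
  | mem y hy =>
    obtain ⟨t, g, hg, rfl⟩ := hy
    exact ⟨g, by simpa using hg, by simpa using (cechFrac_spec x ∅ g t).symm⟩
  | zero => exact ⟨0, zero_mem _, map_zero _⟩
  | add a b _ _ ha hb =>
    obtain ⟨r, hr, rfl⟩ := ha
    obtain ⟨s, hs, rfl⟩ := hb
    exact ⟨r + s, add_mem hr hs, map_add _ _ _⟩
  | neg a _ ha =>
    obtain ⟨r, hr, rfl⟩ := ha
    exact ⟨-r, neg_mem hr, map_neg _ _⟩

theorem algebraMap_cechTerm_injective (x : Fin m → R) {I : Finset (Fin m)} (hI : I = ∅) :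
    Function.Injective (algebraMap R (CechTerm x I)) := by
  subst hI
  exact (IsLocalization.atUnit R (CechTerm x ∅) (subProd x ∅) (by simp)).injective

variable [GradedRing 𝒢]

/-- The coaction `r ↦ ∑ₙ rₙ Tⁿ` that encodes the grading of `R`. -/
def coaction : R →+* R[T;T⁻¹] :=
  (DirectSum.toSemiring
    (fun n : ℤ => ((AddMonoidHom.mulRight (T n)).comp
      (C : R →+* R[T;T⁻¹]).toAddMonoidHom).comp (𝒢 n).subtype)
    (by simp)
    (by
      intro i j a b
      simp only [AddMonoidHom.comp_apply, AddMonoidHom.mulRight_apply, T_add]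
      change C ((a : R) * b) * _ = C (a : R) * _ * (C (b : R) * _)
      rw [map_mul]; ring)).comp (DirectSum.decomposeRingEquiv 𝒢 : R →+* ⨁ n, 𝒢 n)

variable {𝒢}

theorem coaction_of_mem {n : ℤ} {r : R} (hr : r ∈ 𝒢 n) : coaction 𝒢 r = C r * T n := by
  have h : DirectSum.decomposeRingEquiv 𝒢 r = DirectSum.of _ n ⟨r, hr⟩ :=
    DirectSum.decompose_of_mem 𝒢 hr
  simp only [coaction, RingHom.comp_apply, RingHom.coe_coe, h, DirectSum.toSemiring_of]
  rfl

theorem subProd_mem {x : Fin m → R} (hx : ∀ j, x j ∈ 𝒢 1) (I : Finset (Fin m)) :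
    subProd x I ∈ 𝒢 I.card := by
  simpa using SetLike.prod_mem_graded (A := 𝒢) (fun _ => (1 : ℤ)) x (F := I) fun j _ => hx j

variable {x : Fin m → R} (hx : ∀ j, x j ∈ 𝒢 1)

theorem coaction_subProd_isUnit (hx : ∀ j, x j ∈ 𝒢 1) (I : Finset (Fin m)) :
    IsUnit ((AddMonoidAlgebra.mapRingHom ℤ (algebraMap R (CechTerm x I))).comp (coaction 𝒢)
      (subProd x I)) := by
  rw [RingHom.comp_apply, coaction_of_mem (subProd_mem hx I), mapRingHom_C_mul_T]
  exact ((isUnit_subProd x (subset_refl I)).map _).mul (isUnit_T _)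

/-- The extension of the coaction to the localization `R_{x_I}`. -/
def cechCoaction (hx : ∀ j, x j ∈ 𝒢 1) (I : Finset (Fin m)) :
    CechTerm x I →+* (CechTerm x I)[T;T⁻¹] :=
  IsLocalization.Away.lift (subProd x I) (coaction_subProd_isUnit hx I)

theorem cechCoaction_algebraMap (I : Finset (Fin m)) (r : R) :
    cechCoaction hx I (algebraMap R _ r) =
      AddMonoidAlgebra.mapRingHom ℤ (algebraMap R (CechTerm x I)) (coaction 𝒢 r) :=
  IsLocalization.Away.lift_eq _ _ _

theorem cechCoaction_algebraMap_of_mem (I : Finset (Fin m)) {n : ℤ} {r : R} (hr : r ∈ 𝒢 n) :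
    cechCoaction hx I (algebraMap R _ r) = C (algebraMap R _ r) * T n := by
  rw [cechCoaction_algebraMap, coaction_of_mem hr, mapRingHom_C_mul_T]

theorem cechCoaction_restrict {I J : Finset (Fin m)} (h : I ⊆ J) (y : CechTerm x I) :
    cechCoaction hx J (cechRestrict x h y) =
      AddMonoidAlgebra.mapRingHom ℤ (cechRestrict x h).toRingHom (cechCoaction hx I y) := by
  refine DFunLike.congr_fun (f := (cechCoaction hx J).comp (cechRestrict x h).toRingHom)
    (g := (AddMonoidAlgebra.mapRingHom ℤ (cechRestrict x h).toRingHom).comp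
      (cechCoaction hx I)) ?_ y
  refine IsLocalization.ringHom_ext (Submonoid.powers (subProd x I)) ?_
  ext1 r
  change cechCoaction hx J (cechRestrict x h (algebraMap R _ r)) =
    AddMonoidAlgebra.mapRingHom ℤ (cechRestrict x h).toRingHom
      (cechCoaction hx I (algebraMap R _ r))
  rw [AlgHom.commutes, cechCoaction_algebraMap, cechCoaction_algebraMap]
  ext n
  simp

theorem cechCoaction_cechFrac (I : Finset (Fin m)) {n : ℤ} {t : ℕ} {g : R}
    (hg : g ∈ 𝒢 (n + t * I.card)) :
    cechCoaction hx I (cechFrac x I g t) = C (cechFrac x I g t) * T n := by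
  have hu : IsUnit (C (algebraMap R (CechTerm x I) (subProd x I)) * T I.card :
      (CechTerm x I)[T;T⁻¹]) :=
    ((isUnit_subProd x (subset_refl I)).map _).mul (isUnit_T _)
  refine (hu.pow t).mul_right_cancel ?_
  rw [← cechCoaction_algebraMap_of_mem hx I (subProd_mem hx I), ← map_pow, ← map_mul,
    cechFrac_spec, cechCoaction_algebraMap_of_mem hx I hg, map_pow,
    cechCoaction_algebraMap_of_mem hx I (subProd_mem hx I), mul_pow, T_pow,
    ← cechFrac_spec x I g t, map_mul, map_pow, T_add]
  ring

theorem cechCoaction_of_mem {I : Finset (Fin m)} {n : ℤ} {y : CechTerm x I}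
    (hy : y ∈ cechPiece 𝒢 x I n) : cechCoaction hx I y = C y * T n := by
  induction hy using AddSubgroup.closure_induction with
  | mem y hy =>
    obtain ⟨t, g, hg, rfl⟩ := hy
    exact cechCoaction_cechFrac hx I hg
  | zero => simp
  | add a b _ _ ha hb => rw [map_add, ha, hb, map_add, add_mul]
  | neg a _ ha => rw [map_neg, ha, map_neg]; ring

/-- The component of degree `n` of an element of `R_{x_I}`. -/
def cechProj (hx : ∀ j, x j ∈ 𝒢 1) (I : Finset (Fin m)) (n : ℤ) :
    CechTerm x I →+ CechTerm x I where
  toFun y := (cechCoaction hx I y).coeff n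
  map_zero' := by simp
  map_add' := by simp

theorem cechProj_of_mem {I : Finset (Fin m)} {n : ℤ} {y : CechTerm x I}
    (hy : y ∈ cechPiece 𝒢 x I n) : cechProj hx I n y = y := by
  change (cechCoaction hx I y).coeff n = y
  rw [cechCoaction_of_mem hx hy, coeff_C_mul_T, if_pos rfl]

theorem cechProj_mem (I : Finset (Fin m)) (n : ℤ) (y : CechTerm x I) :
    cechProj hx I n y ∈ cechPiece 𝒢 x I n := by
  obtain ⟨a, t, rfl⟩ := exists_cechFrac x I y
  induction a using DirectSum.Decomposition.inductionOn 𝒢 with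
  | zero =>
    have : cechFrac x I 0 t = 0 := by
      simpa using cechFrac_add x I 0 0 t
    rw [this, map_zero]
    exact zero_mem _
  | @homogeneous l a =>
    have ha : (a : R) ∈ 𝒢 (l - t * I.card + t * I.card) := by simp
    change (cechCoaction hx I (cechFrac x I a t)).coeff n ∈ _
    rw [cechCoaction_cechFrac hx I ha, coeff_C_mul_T]
    split_ifs with hl
    · exact AddSubgroup.subset_closure ⟨t, a, hl ▸ ha, rfl⟩
    · exact zero_mem _
  | add a b ha hb =>
    rw [cechFrac_add, map_add]
    exact add_mem ha hb

/-- The homogeneous elements of `R_{x_I}` are those on which the coaction is `y ↦ y Tⁿ`. -/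
theorem mem_cechPiece_iff {I : Finset (Fin m)} {n : ℤ} {y : CechTerm x I} :
    y ∈ cechPiece 𝒢 x I n ↔ cechCoaction hx I y = C y * T n := by
  refine ⟨cechCoaction_of_mem hx, fun h => ?_⟩
  have := cechProj_mem hx I n y
  change (cechCoaction hx I y).coeff n ∈ _ at this
  rwa [h, coeff_C_mul_T, if_pos rfl] at this

theorem cechProj_restrict {I J : Finset (Fin m)} (h : I ⊆ J) (n : ℤ) (y : CechTerm x I) :
    cechProj hx J n (cechRestrict x h y) = cechRestrict x h (cechProj hx I n y) := by
  change (cechCoaction hx J (cechRestrict x h y)).coeff n = _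
  rw [cechCoaction_restrict, AddMonoidAlgebra.coeff_mapRingHom]
  rfl

include hx

theorem cechRestrict_mem {I J : Finset (Fin m)} (h : I ⊆ J) {n : ℤ} {y : CechTerm x I}
    (hy : y ∈ cechPiece 𝒢 x I n) : cechRestrict x h y ∈ cechPiece 𝒢 x J n := by
  rw [mem_cechPiece_iff hx] at hy ⊢
  rw [cechCoaction_restrict, hy, mapRingHom_C_mul_T]
  rfl

/-- The grading of `R_{x_I}` is shifted by multiplication with the unit `x_K`, `K ⊆ I`. -/
theorem subProd_smul_mem_iff {K I : Finset (Fin m)} (h : K ⊆ I) {n : ℤ} {y : CechTerm x I} :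
    subProd x K • y ∈ cechPiece 𝒢 x I (n + K.card) ↔ y ∈ cechPiece 𝒢 x I n := by
  have hu : IsUnit (C (algebraMap R (CechTerm x I) (subProd x K)) * T K.card :
      (CechTerm x I)[T;T⁻¹]) :=
    ((isUnit_subProd x h).map _).mul (isUnit_T _)
  have h1 : cechCoaction hx I (subProd x K • y) =
      C (algebraMap R (CechTerm x I) (subProd x K)) * T K.card * cechCoaction hx I y := by
    rw [Algebra.smul_def, map_mul, cechCoaction_algebraMap_of_mem hx I (subProd_mem hx K)]
  have h2 : C (subProd x K • y) * T (n + K.card) =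
      C (algebraMap R (CechTerm x I) (subProd x K)) * T K.card * (C y * T n) := by
    rw [Algebra.smul_def, map_mul, T_add]
    ring
  rw [mem_cechPiece_iff hx, mem_cechPiece_iff hx, h1, h2]
  exact hu.mul_right_inj

theorem smul_mem_cechPiece {I : Finset (Fin m)} {n l : ℤ} {r : R} (hr : r ∈ 𝒢 l)
    {y : CechTerm x I} (hy : y ∈ cechPiece 𝒢 x I n) : r • y ∈ cechPiece 𝒢 x I (n + l) := by
  rw [mem_cechPiece_iff hx] at hy ⊢
  rw [Algebra.smul_def, map_mul, cechCoaction_algebraMap_of_mem hx I hr, hy, map_mul, T_add]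
  ring

end CechGrading

/-! ### Splitting a cube complex along one direction -/

section CubeSplit

variable {R : Type*} [CommRing R] {m : ℕ} {j : Fin m}

/-- The differential of the cube complex on the subsets not containing `j`, for a family of
modules that is only given on these subsets. -/
def linkD (N : {I : Finset (Fin m) // j ∉ I} → Type*) [∀ I, AddCommGroup (N I)]
    [∀ I, Module R (N I)]
    (σ : ∀ ⦃I J : {I : Finset (Fin m) // j ∉ I}⦄, I.1 ⊆ J.1 → (N I →ₗ[R] N J)) :
    (∀ I, N I) →ₗ[R] (∀ I, N I) :=
  LinearMap.pi fun J => ∑ l ∈ J.1, (-1 : ℤ) ^ (J.1.filter (· < l)).card •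
    (σ (I := ⟨J.1.erase l, fun h => J.2 (Finset.mem_of_mem_erase h)⟩) (J.1.erase_subset l) ∘ₗ
      LinearMap.proj _)

theorem linkD_apply (N : {I : Finset (Fin m) // j ∉ I} → Type*) [∀ I, AddCommGroup (N I)]
    [∀ I, Module R (N I)]
    (σ : ∀ ⦃I J : {I : Finset (Fin m) // j ∉ I}⦄, I.1 ⊆ J.1 → (N I →ₗ[R] N J))
    (u : ∀ I, N I) (J : {I : Finset (Fin m) // j ∉ I}) :
    linkD N σ u J = ∑ l ∈ J.1, (-1 : ℤ) ^ (J.1.filter (· < l)).card •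
      σ (I := ⟨J.1.erase l, fun h => J.2 (Finset.mem_of_mem_erase h)⟩) (J.1.erase_subset l)
        (u _) := by
  simp [linkD]

theorem cubeD_apply (M : Finset (Fin m) → Type*) [∀ I, AddCommGroup (M I)]
    [∀ I, Module R (M I)] (ρ : ∀ ⦃I J : Finset (Fin m)⦄, I ⊆ J → (M I →ₗ[R] M J))
    (c : ∀ I, M I) (J : Finset (Fin m)) :
    cubeD M ρ c J = ∑ l ∈ J, (-1 : ℤ) ^ (J.filter (· < l)).card •
      ρ (J.erase_subset l) (c (J.erase l)) := by
  simp [cubeD]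

/-- Compatible maps between the modules of two cubes commute with the differentials. -/
theorem linkD_map {N N' : {I : Finset (Fin m) // j ∉ I} → Type*} [∀ I, AddCommGroup (N I)]
    [∀ I, Module R (N I)] [∀ I, AddCommGroup (N' I)] [∀ I, Module R (N' I)]
    {σ : ∀ ⦃I J : {I : Finset (Fin m) // j ∉ I}⦄, I.1 ⊆ J.1 → (N I →ₗ[R] N J)}
    {σ' : ∀ ⦃I J : {I : Finset (Fin m) // j ∉ I}⦄, I.1 ⊆ J.1 → (N' I →ₗ[R] N' J)}
    (f : ∀ I, N I →ₗ[R] N' I)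
    (hf : ∀ ⦃I J : {I : Finset (Fin m) // j ∉ I}⦄ (h : I.1 ⊆ J.1) y, f J (σ h y) = σ' h (f I y))
    (u : ∀ I, N I) :
    LinearMap.piMap f (linkD N σ u) = linkD N' σ' (LinearMap.piMap f u) := by
  ext J
  change f J (linkD N σ u J) = _
  rw [linkD_apply, linkD_apply, map_sum]
  refine Finset.sum_congr rfl fun l _ => ?_
  rw [map_zsmul, hf]
  rfl

/-- The sign rule that makes the part of a cube differential in direction `j` anticommute with the
parts in the other directions. -/
theorem sign_insert {J : Finset (Fin m)} (hj : j ∉ J) {l : Fin m} (hl : l ∈ J) :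
    (-1 : ℤ) ^ (J.filter (· < j)).card * (-1 : ℤ) ^ ((insert j J).filter (· < l)).card =
      -((-1 : ℤ) ^ (J.filter (· < l)).card * (-1 : ℤ) ^ ((J.erase l).filter (· < j)).card) := by
  have hne : l ≠ j := fun h => hj (h ▸ hl)
  rw [Finset.filter_insert, Finset.filter_erase]
  rcases lt_or_gt_of_ne hne with h | h
  · have hmem : l ∈ J.filter (· < j) := Finset.mem_filter.2 ⟨hl, h⟩
    rw [if_neg h.le.not_gt, ← Finset.card_erase_add_one hmem, pow_succ]
    ring
  · have hmem : l ∉ J.filter (· < j) := fun h' => h.not_gt (Finset.mem_filter.1 h').2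
    rw [if_pos h, Finset.erase_eq_of_notMem hmem, Finset.card_insert_of_notMem, pow_succ]
    · ring
    · exact fun h' => hj (Finset.mem_filter.1 h').1

variable {M : Finset (Fin m) → Type*} [∀ I, AddCommGroup (M I)] [∀ I, Module R (M I)]
  {N N' : {I : Finset (Fin m) // j ∉ I} → Type*} [∀ I, AddCommGroup (N I)]
  [∀ I, Module R (N I)] [∀ I, AddCommGroup (N' I)] [∀ I, Module R (N' I)]
  (α : ∀ I : {I : Finset (Fin m) // j ∉ I}, M I ≃ₗ[R] N I)
  (β : ∀ I : {I : Finset (Fin m) // j ∉ I}, M (insert j I.1) ≃ₗ[R] N' I)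

/-- The two halves of a cochain `c`: the components `c_I` with `j ∉ I`, and the components
`c_{I ∪ {j}}` with `j ∉ I`, the latter with the sign that makes the second half of the
differential the negative of a cube differential. The modules of the halves are given up to
isomorphisms `α` and `β`. -/
def cubeSplit : (∀ I, M I) →ₗ[R] (∀ I, N I) × (∀ I, N' I) :=
  LinearMap.prod (LinearMap.pi fun I => (α I).toLinearMap ∘ₗ LinearMap.proj I.1)
    (LinearMap.pi fun I => (-1 : ℤ) ^ (I.1.filter (· < j)).card •
      ((β I).toLinearMap ∘ₗ LinearMap.proj (insert j I.1)))

theorem cubeSplit_fst (c : ∀ I, M I) (I : {I : Finset (Fin m) // j ∉ I}) :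
    (cubeSplit α β c).1 I = α I (c I) := rfl

theorem cubeSplit_snd (c : ∀ I, M I) (I : {I : Finset (Fin m) // j ∉ I}) :
    (cubeSplit α β c).2 I = (-1 : ℤ) ^ (I.1.filter (· < j)).card • β I (c (insert j I.1)) := rfl

theorem neg_one_pow_smul_smul {E : Type*} [AddCommGroup E] (a : ℕ) (y : E) :
    (-1 : ℤ) ^ a • (-1 : ℤ) ^ a • y = y := by
  rw [smul_smul, ← mul_pow]
  simp

theorem neg_one_pow_smul_eq_zero {E : Type*} [AddCommGroup E] (a : ℕ) {y : E} :
    (-1 : ℤ) ^ a • y = 0 ↔ y = 0 :=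
  ⟨fun h => by rw [← neg_one_pow_smul_smul a y, h, smul_zero], fun h => by rw [h, smul_zero]⟩

theorem neg_one_pow_smul_mem {E : Type*} [AddCommGroup E] (P : AddSubgroup E) (a : ℕ) {y : E} :
    (-1 : ℤ) ^ a • y ∈ P ↔ y ∈ P :=
  ⟨fun h => by rw [← neg_one_pow_smul_smul a y]; exact zsmul_mem h _, fun h => zsmul_mem h _⟩

theorem exists_eq_insert_of_mem {J : Finset (Fin m)} (h : j ∈ J) :
    ∃ I : {I : Finset (Fin m) // j ∉ I}, J = insert j I.1 :=
  ⟨⟨J.erase j, Finset.notMem_erase j J⟩, (Finset.insert_erase h).symm⟩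

theorem cubeSplit_bijective : Function.Bijective (cubeSplit α β) := by
  constructor
  · rw [injective_iff_map_eq_zero]
    intro c hc
    funext J
    by_cases hJ : j ∈ J
    · obtain ⟨I, rfl⟩ := exists_eq_insert_of_mem hJ
      have h : (cubeSplit α β c).2 I = 0 := by rw [hc]; rfl
      rw [cubeSplit_snd, neg_one_pow_smul_eq_zero] at h
      exact (β I).map_eq_zero_iff.1 h
    · have h : (cubeSplit α β c).1 ⟨J, hJ⟩ = 0 := by rw [hc]; rfl
      exact (α ⟨J, hJ⟩).map_eq_zero_iff.1 h
  · rintro ⟨u, v⟩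
    have key : ∀ J : Finset (Fin m), ∃ y : M J, (∀ h : j ∉ J, α ⟨J, h⟩ y = u ⟨J, h⟩) ∧
        ∀ (I : {I : Finset (Fin m) // j ∉ I}) (h : J = insert j I.1),
          (-1 : ℤ) ^ (I.1.filter (· < j)).card • β I (h ▸ y) = v I := by
      intro J
      by_cases hJ : j ∈ J
      · obtain ⟨I, rfl⟩ := exists_eq_insert_of_mem hJ
        refine ⟨(-1 : ℤ) ^ (I.1.filter (· < j)).card • (β I).symm (v I),
          fun h => (h hJ).elim, fun I' h => ?_⟩
        obtain rfl : I = I' := by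
          apply Subtype.ext
          rw [← Finset.erase_insert I.2, h, Finset.erase_insert I'.2]
        rw [map_zsmul, neg_one_pow_smul_smul, LinearEquiv.apply_symm_apply]
      · refine ⟨(α ⟨J, hJ⟩).symm (u ⟨J, hJ⟩), fun h => LinearEquiv.apply_symm_apply _ _,
          fun I h => (hJ (h ▸ Finset.mem_insert_self j I.1)).elim⟩
    choose c hc hc' using key
    refine ⟨c, Prod.ext ?_ ?_⟩
    · funext I
      exact hc I.1 I.2
    · funext I
      exact hc' _ I rfl

/-- The two halves of the differential of a cube complex: if `λ` is given by the transition maps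
`M I → M (I ∪ {j})`, then the cube complex is the fibre of the map of complexes `λ`. -/
theorem cubeSplit_cubeD {ρ : ∀ ⦃I J : Finset (Fin m)⦄, I ⊆ J → (M I →ₗ[R] M J)}
    {σ : ∀ ⦃I J : {I : Finset (Fin m) // j ∉ I}⦄, I.1 ⊆ J.1 → (N I →ₗ[R] N J)}
    {σ' : ∀ ⦃I J : {I : Finset (Fin m) // j ∉ I}⦄, I.1 ⊆ J.1 → (N' I →ₗ[R] N' J)}
    {f : ∀ I, N I →ₗ[R] N' I}
    (hα : ∀ ⦃I J : {I : Finset (Fin m) // j ∉ I}⦄ (h : I.1 ⊆ J.1) y,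
      α J (ρ h y) = σ h (α I y))
    (hβ : ∀ ⦃I J : {I : Finset (Fin m) // j ∉ I}⦄ (h : I.1 ⊆ J.1) y,
      β J (ρ (Finset.insert_subset_insert j h) y) = σ' h (β I y))
    (hf : ∀ (I : {I : Finset (Fin m) // j ∉ I}) y,
      β I (ρ (Finset.subset_insert j I.1) y) = f I (α I y)) (c : ∀ I, M I) :
    cubeSplit α β (cubeD M ρ c) = (linkD N σ (cubeSplit α β c).1,
      LinearMap.piMap f (cubeSplit α β c).1 - linkD N' σ' (cubeSplit α β c).2) := by
  have hcast : ∀ {K K' J : Finset (Fin m)} (e : K = K') (h : K ⊆ J) (h' : K' ⊆ J),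
      ρ h (c K) = ρ h' (c K') := by
    rintro K _ J rfl h h'
    rfl
  refine Prod.ext (funext fun J => ?_) (funext fun J => ?_)
  · change _ = linkD N σ (cubeSplit α β c).1 J
    rw [cubeSplit_fst, cubeD_apply, linkD_apply, map_sum]
    refine Finset.sum_congr rfl fun l _ => ?_
    rw [map_zsmul]
    congr 1
    exact hα (I := ⟨J.1.erase l, fun h => J.2 (Finset.mem_of_mem_erase h)⟩) _ _
  · rw [cubeSplit_snd, cubeD_apply, Finset.sum_insert J.2]
    change _ = f J ((cubeSplit α β c).1 J) - linkD N' σ' (cubeSplit α β c).2 J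
    rw [linkD_apply, map_add, map_zsmul, smul_add, sub_eq_add_neg]
    congr 1
    · rw [Finset.filter_insert, if_neg (lt_irrefl j), neg_one_pow_smul_smul,
        hcast (Finset.erase_insert J.2) _ (Finset.subset_insert j J.1), hf]
      rfl
    · rw [map_sum, Finset.smul_sum, ← Finset.sum_neg_distrib]
      refine Finset.sum_congr rfl fun l hl => ?_
      have hne : j ≠ l := fun h => J.2 (h ▸ hl)
      rw [map_zsmul, smul_smul, sign_insert J.2 hl, cubeSplit_snd, map_zsmul, smul_smul, neg_smul,
        hcast (Finset.erase_insert_of_ne hne) _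
          (Finset.insert_subset_insert j (J.1.erase_subset l)),
        hβ (I := ⟨J.1.erase l, fun h => J.2 (Finset.mem_of_mem_erase h)⟩)]

end CubeSplit

/-! ### Replacing a localization by multiplication in a fibre -/

section Fibre

variable {R : Type*} [CommRing R]

/-- Every cocycle of bidegree `(i, s - i)` is the coboundary of a cochain of bidegree
`(i - 1, s - i)`. Here `P i n` stands for the cochains of cohomological degree `i` that are
homogeneous of degree `n`. -/
def ExactOnDiagonal {T : Type*} [AddCommGroup T] [Module R T] (d : T →ₗ[R] T)
    (P : ℤ → ℤ → AddSubgroup T) (s : ℤ) : Prop :=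
  ∀ i, ∀ c ∈ P i (s - i), d c = 0 → ∃ b ∈ P (i - 1) (s - i), d b = c

theorem ExactOnDiagonal.congr {T T' : Type*} [AddCommGroup T] [Module R T] [AddCommGroup T']
    [Module R T'] {d : T →ₗ[R] T} {d' : T' →ₗ[R] T'} {P : ℤ → ℤ → AddSubgroup T}
    {P' : ℤ → ℤ → AddSubgroup T'} {s : ℤ} {e : T →ₗ[R] T'} (he : Function.Bijective e)
    (hd : ∀ c, e (d c) = d' (e c)) (hP : ∀ i n c, e c ∈ P' i n ↔ c ∈ P i n) :
    ExactOnDiagonal d P s ↔ ExactOnDiagonal d' P' s := by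
  constructor
  · intro h i c hc hdc
    obtain ⟨c, rfl⟩ := he.2 c
    obtain ⟨b, hb, rfl⟩ := h i c ((hP _ _ _).1 hc) (he.1 (by rw [hd, hdc, map_zero]))
    exact ⟨e b, (hP _ _ _).2 hb, (hd b).symm⟩
  · intro h i c hc hdc
    obtain ⟨b, hb, hbc⟩ := h i (e c) ((hP _ _ _).2 hc) (by rw [← hd, hdc, map_zero])
    obtain ⟨b, rfl⟩ := he.2 b
    exact ⟨b, (hP _ _ _).1 hb, he.1 (by rw [hd, hbc])⟩

variable {U V : Type*} [AddCommGroup U] [Module R U] [AddCommGroup V] [Module R V]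

/-- The differential of the fibre of a map `f : U → V` of complexes. -/
def fibreD (dU : U →ₗ[R] U) (dV : V →ₗ[R] V) (f : U →ₗ[R] V) : U × V →ₗ[R] U × V :=
  (dU ∘ₗ LinearMap.fst R U V).prod (f ∘ₗ LinearMap.fst R U V - dV ∘ₗ LinearMap.snd R U V)

theorem fibreD_apply (dU : U →ₗ[R] U) (dV : V →ₗ[R] V) (f : U →ₗ[R] V) (u : U) (v : V) :
    fibreD dU dV f (u, v) = (dU u, f u - dV v) := rfl

/-- The bihomogeneous elements of the fibre of a map `U → V` of complexes. -/
def fibreHomog (P : ℤ → ℤ → AddSubgroup U) (P' : ℤ → ℤ → AddSubgroup V) (i n : ℤ) :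
    AddSubgroup (U × V) :=
  (P i n).prod (P' (i - 1) n)

theorem mem_fibreHomog {P : ℤ → ℤ → AddSubgroup U} {P' : ℤ → ℤ → AddSubgroup V} {i n : ℤ} {u : U}
    {v : V} : (u, v) ∈ fibreHomog P P' i n ↔ u ∈ P i n ∧ v ∈ P' (i - 1) n := Iff.rfl

variable {dU : U →ₗ[R] U} {dV : V →ₗ[R] V} {f : U →ₗ[R] V} {r : R}
  {P : ℤ → ℤ → AddSubgroup U} {P' : ℤ → ℤ → AddSubgroup V} {k : ℤ}

/-- Let `U → V` be a map of complexes such that `r` is bijective on `V`. If the fibre of `U → V`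
is exact on a diagonal, then so is the fibre of `r : U → U`. -/
theorem ExactOnDiagonal.fibre_smul (hf : ∀ u, f (dU u) = dV (f u))
    (hr : Function.Bijective fun v : V => r • v)
    (hP : ∀ i n u, u ∈ P i n → r • u ∈ P i (n + 1))
    (hP' : ∀ i n v, r • v ∈ P' i (n + 1) ↔ v ∈ P' i n)
    (hPP' : ∀ i n u, u ∈ P i n → f u ∈ P' i n)
    (h : ExactOnDiagonal (fibreD dU dV f) (fibreHomog P P') k) :
    ExactOnDiagonal (fibreD dU dU (r • LinearMap.id))
      (fibreHomog P fun i n => P i (n + 1)) k := by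
  rintro i ⟨u, u'⟩ huu' hd
  obtain ⟨hu, hu'⟩ := mem_fibreHomog.1 huu'
  simp only [fibreD_apply, Prod.mk_eq_zero, sub_eq_zero, LinearMap.smul_apply,
    LinearMap.id_apply] at hd
  obtain ⟨hd, hd'⟩ := hd
  obtain ⟨v, hv⟩ := hr.2 (f u')
  simp only at hv
  -- `(u, u' / r)` is a cocycle of the fibre of `U → V`.
  obtain ⟨⟨w, v₁⟩, hwv₁, hwv⟩ := h i (u, v) ⟨hu, (hP' _ _ _).1 (hv ▸ hPP' _ _ _ hu')⟩ (by
    simp only [fibreD_apply, Prod.mk_eq_zero, sub_eq_zero]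
    refine ⟨hd, hr.1 ?_⟩
    simp only [← map_smul, hv, ← hf, hd'])
  obtain ⟨hw, hv₁⟩ := mem_fibreHomog.1 hwv₁
  simp only [fibreD_apply, Prod.mk.injEq] at hwv
  obtain ⟨rfl, hwv⟩ := hwv
  -- Subtracting a coboundary, only the cocycle `u' - r w` of `U` is left.
  obtain ⟨⟨p, q⟩, hpq', hpq⟩ := h (i - 1) (u' - r • w, -(r • v₁))
    (mem_fibreHomog.2 ⟨by
      rw [show k - (i - 1) = k - i + 1 by ring]
      exact sub_mem hu' (hP _ _ _ hw), by
      rw [show k - (i - 1) = k - i + 1 by ring]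
      exact neg_mem ((hP' _ _ _).2 hv₁)⟩) (by
    simp only [fibreD_apply, Prod.mk_eq_zero, map_sub, map_neg, map_smul, ← hd', ← hv, ← hwv,
      smul_sub]
    exact ⟨sub_self _, by abel⟩)
  have hp := (mem_fibreHomog.1 hpq').1
  simp only [fibreD_apply, Prod.mk.injEq] at hpq
  refine ⟨(w, -p), mem_fibreHomog.2 ⟨hw, neg_mem ?_⟩, ?_⟩
  · rwa [show k - (i - 1) = k - i + 1 by ring] at hp
  · simp only [fibreD_apply, map_neg, hpq.1, LinearMap.smul_apply, LinearMap.id_apply]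
    exact Prod.ext rfl (by simp)

/-- Let `U → V` be a map of complexes such that `r` is bijective on `V`. If the fibre of `U → V`
is exact on the diagonal `k + 1`, then up to coboundaries every cocycle on the diagonal `k` comes
from the fibre of `r : U → U`, through the map `(u, u') ↦ (u, u' / r)`. -/
theorem ExactOnDiagonal.exists_fibre_smul (hr : Function.Bijective fun v : V => r • v)
    (hP : ∀ i n u, u ∈ P i n → r • u ∈ P i (n + 1))
    (hP' : ∀ i n v, r • v ∈ P' i (n + 1) ↔ v ∈ P' i n)
    (h : ExactOnDiagonal (fibreD dU dV f) (fibreHomog P P') (k + 1)) {i : ℤ} {u : U} {v : V}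
    (huv : (u, v) ∈ fibreHomog P P' i (k - i)) (hd : fibreD dU dV f (u, v) = 0) :
    ∃ u', (u, u') ∈ fibreHomog P (fun i n => P i (n + 1)) i (k - i) ∧
      fibreD dU dU (r • LinearMap.id) (u, u') = 0 ∧
      ∃ b ∈ P' (i - 1 - 1) (k - i), r • (v - dV b) = f u' := by
  obtain ⟨hu, hv⟩ := mem_fibreHomog.1 huv
  simp only [fibreD_apply, Prod.mk_eq_zero, sub_eq_zero] at hd
  obtain ⟨hd, hd'⟩ := hd
  obtain ⟨⟨u', v'⟩, hmem, huv'⟩ := h i (r • u, r • v)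
    ⟨by
      rw [show k + 1 - i = k - i + 1 by ring]
      exact hP _ _ _ hu, by
      rw [show k + 1 - i = k - i + 1 by ring]
      exact (hP' _ _ _).2 hv⟩ (by
    simp only [fibreD_apply, map_smul, hd, hd', smul_zero, sub_self]
    rfl)
  obtain ⟨hu', hv'⟩ := mem_fibreHomog.1 hmem
  simp only [fibreD_apply, Prod.mk.injEq] at huv'
  rw [show k + 1 - i = k - i + 1 by ring] at hu' hv'
  obtain ⟨b, hb⟩ := hr.2 v'
  simp only at hb
  refine ⟨u', ⟨hu, hu'⟩, ?_, -b, neg_mem ((hP' _ _ _).1 (hb ▸ hv')), ?_⟩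
  · simp only [fibreD_apply, hd, huv'.1, LinearMap.smul_apply, LinearMap.id_apply, sub_self]
    rfl
  · rw [smul_sub, ← huv'.2, ← map_smul, smul_neg, hb, map_neg]
    abel

end Fibre

/-! ### The complexes between the Koszul and the Čech complex -/

noncomputable section Mixed

variable {R : Type*} [CommRing R] {m : ℕ}

theorem subProd_empty (x : Fin m → R) : subProd x ∅ = 1 := Finset.prod_empty

theorem subProd_singleton (x : Fin m → R) (j : Fin m) : subProd x {j} = x j :=
  Finset.prod_singleton _ _

theorem subProd_union (x : Fin m → R) {I J : Finset (Fin m)} (h : Disjoint I J) :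
    subProd x (I ∪ J) = subProd x I * subProd x J := Finset.prod_union h

variable {x : Fin m → R} {F : Finset (Fin m) → Type*} [∀ I, AddCommGroup (F I)]
  [∀ I, Module R (F I)]

variable (x F) in
/-- The properties of the localizations `F I = R_{x_I}` of a graded ring, `x_j` of degree one,
that the comparison of the Koszul and the Čech complex depends on. -/
structure GradedCube where
  /-- The transition maps. -/
  res : ∀ ⦃I J : Finset (Fin m)⦄, I ⊆ J → (F I →ₗ[R] F J)
  res_self : ∀ {I : Finset (Fin m)} (h : I ⊆ I) (y : F I), res h y = y
  res_trans : ∀ {I J K : Finset (Fin m)} (h : I ⊆ J) (h' : J ⊆ K) (y : F I),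
    res h' (res h y) = res (h.trans h') y
  /-- The homogeneous elements of degree `n`. -/
  piece : ∀ (I : Finset (Fin m)) (_n : ℤ), AddSubgroup (F I)
  /-- The products `x_K`, `K ⊆ I`, are invertible on `F I`. -/
  smul_bijective : ∀ {K I : Finset (Fin m)}, K ⊆ I →
    Function.Bijective fun y : F I => subProd x K • y
  res_mem : ∀ {I J : Finset (Fin m)} (h : I ⊆ J) {n : ℤ} {y : F I}, y ∈ piece I n →
    res h y ∈ piece J n
  smul_mem : ∀ (j : Fin m) {I : Finset (Fin m)} {n : ℤ} {y : F I}, y ∈ piece I n →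
    x j • y ∈ piece I (n + 1)
  /-- The inverse of `x_j` on `F I`, `j ∈ I`, has degree `-1`. -/
  smul_mem_iff : ∀ {j : Fin m} {I : Finset (Fin m)}, j ∈ I → ∀ {n : ℤ} {y : F I},
    x j • y ∈ piece I (n + 1) ↔ y ∈ piece I n

/-- The transition map `R_{x_{I ∖ S}} → R_{x_{J ∖ S}}` of the mixed complex. -/
def mixRestrict (L : GradedCube x F) (S : Finset (Fin m)) ⦃I J : Finset (Fin m)⦄ (h : I ⊆ J) :
    F (I \ S) →ₗ[R] F (J \ S) :=
  subProd x ((J \ I) ∩ S) • (L.res (Finset.sdiff_subset_sdiff h subset_rfl))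

/-- The differential of the mixed complex `⨂_{j ∈ S} K^•(x_j) ⊗ ⨂_{j ∉ S} C^•(x_j)`, the tensor
product of the Koszul complexes of the `x_j`, `j ∈ S`, and the Čech complexes of the remaining
`x_j`. Its component at `I` is `R_{x_{I ∖ S}}`. -/
def mixD (L : GradedCube x F) (S : Finset (Fin m)) :
    (∀ I, F (I \ S)) →ₗ[R] (∀ I, F (I \ S)) :=
  cubeD (fun I => F (I \ S)) (mixRestrict L S)

/-- The cochains of cohomological degree `i` of the mixed complex that are homogeneous of degree
`n`: the generator at `I` has degree `-#(I ∩ S)`. -/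
def mixHomog (L : GradedCube x F) (S : Finset (Fin m)) (i n : ℤ) :
    AddSubgroup (∀ I, F (I \ S)) where
  carrier := {c | ∀ I, ((I.card : ℤ) ≠ i → c I = 0) ∧
    c I ∈ L.piece (I \ S) (n + (I ∩ S).card)}
  zero_mem' := fun _ => ⟨fun _ => rfl, zero_mem _⟩
  add_mem' := fun ha hb I =>
    ⟨fun h => by rw [Pi.add_apply, (ha I).1 h, (hb I).1 h, add_zero], add_mem (ha I).2 (hb I).2⟩
  neg_mem' := fun ha I =>
    ⟨fun h => by rw [Pi.neg_apply, (ha I).1 h, neg_zero], neg_mem (ha I).2⟩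

/-- The bihomogeneous cochains `u` for a family of localizations `R_{x_{K I}}`, given on the
subsets `I` not containing `j`; the degree of the component at `I` is shifted by `s I`. -/
def linkHomog (L : GradedCube x F) {j : Fin m}
    (K : {I : Finset (Fin m) // j ∉ I} → Finset (Fin m)) (s : {I : Finset (Fin m) // j ∉ I} → ℕ)
    (i n : ℤ) : AddSubgroup (∀ I, F (K I)) where
  carrier := {c | ∀ I, ((I.1.card : ℤ) ≠ i → c I = 0) ∧ c I ∈ L.piece (K I) (n + s I)}
  zero_mem' := fun _ => ⟨fun _ => rfl, zero_mem _⟩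
  add_mem' := fun ha hb I =>
    ⟨fun h => by rw [Pi.add_apply, (ha I).1 h, (hb I).1 h, add_zero], add_mem (ha I).2 (hb I).2⟩
  neg_mem' := fun ha I =>
    ⟨fun h => by rw [Pi.neg_apply, (ha I).1 h, neg_zero], neg_mem (ha I).2⟩

theorem mixRestrict_apply (L : GradedCube x F) (S : Finset (Fin m)) {I J : Finset (Fin m)}
    (h : I ⊆ J) (y : F (I \ S)) :
    mixRestrict L S h y = subProd x ((J \ I) ∩ S) •
      L.res (Finset.sdiff_subset_sdiff h subset_rfl) y := rfl

theorem mixRestrict_trans (L : GradedCube x F) (S : Finset (Fin m)) {I J K : Finset (Fin m)}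
    (h : I ⊆ J) (h' : J ⊆ K) (y : F (I \ S)) :
    mixRestrict L S h' (mixRestrict L S h y) = mixRestrict L S (h.trans h') y := by
  have hdisj : Disjoint ((K \ J) ∩ S) ((J \ I) ∩ S) :=
    Disjoint.mono Finset.inter_subset_left
      (Finset.inter_subset_left.trans Finset.sdiff_subset) Finset.sdiff_disjoint
  have hunion : (K \ I) ∩ S = ((K \ J) ∩ S) ∪ ((J \ I) ∩ S) := by
    rw [← Finset.union_inter_distrib_right, Finset.sdiff_union_sdiff_cancel h' h]
  rw [mixRestrict_apply, mixRestrict_apply, mixRestrict_apply, map_smul, L.res_trans,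
    smul_smul, hunion, subProd_union x hdisj]

/-- The isomorphism between the localizations at equal sets of indices. -/
def cechCongr (L : GradedCube x F) {I J : Finset (Fin m)} (h : I = J) :
    F I ≃ₗ[R] F J :=
  LinearEquiv.ofLinearMap (L.res h.subset)
    (L.res h.symm.subset)
    (LinearMap.ext fun y => (L.res_trans h.symm.subset h.subset y).trans
      (L.res_self subset_rfl y))
    (LinearMap.ext fun y => (L.res_trans h.subset h.symm.subset y).trans
      (L.res_self subset_rfl y))

theorem cechCongr_apply (L : GradedCube x F) {I J : Finset (Fin m)} (h : I = J) (y : F I) :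
    cechCongr L h y = L.res h.subset y := rfl

theorem cechCongr_mem_iff (L : GradedCube x F) {I J : Finset (Fin m)}
    (h : I = J) {n : ℤ} {y : F I} :
    cechCongr L h y ∈ L.piece J n ↔ y ∈ L.piece I n := by
  subst h
  rw [cechCongr_apply, L.res_self]

section Step

variable {j : Fin m} {S : Finset (Fin m)}

theorem sdiff_insert_eq {I : Finset (Fin m)} (hI : j ∉ I) : I \ insert j S = I \ S := by
  ext l; simp only [Finset.mem_sdiff, Finset.mem_insert]; grind

theorem insert_sdiff_insert_eq {I : Finset (Fin m)} (hI : j ∉ I) :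
    insert j I \ insert j S = I \ S := by
  ext l; simp only [Finset.mem_sdiff, Finset.mem_insert]; grind

variable (R F) in
/-- The components of a cochain of the mixed complex for `S` along a direction `j ∉ S`. -/
def cechSplit (j : Fin m) (S : Finset (Fin m)) :
    (∀ I, F (I \ S)) →ₗ[R] (∀ I : {I : Finset (Fin m) // j ∉ I}, F (I.1 \ S)) ×
      (∀ I : {I : Finset (Fin m) // j ∉ I}, F (insert j I.1 \ S)) :=
  cubeSplit (M := fun I => F (I \ S)) (fun _ => LinearEquiv.refl R _)
    (fun _ => LinearEquiv.refl R _)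

/-- The components of a cochain of the mixed complex for `S ∪ {j}` along the direction `j`. Both
`I ∖ (S ∪ {j})` and `(I ∪ {j}) ∖ (S ∪ {j})` are `I ∖ S` for `j ∉ I`, so the two halves live in the
same modules. -/
def koszulSplit (L : GradedCube x F) (j : Fin m) (S : Finset (Fin m)) :
    (∀ I, F (I \ insert j S)) →ₗ[R]
      (∀ I : {I : Finset (Fin m) // j ∉ I}, F (I.1 \ S)) ×
      (∀ I : {I : Finset (Fin m) // j ∉ I}, F (I.1 \ S)) :=
  cubeSplit (M := fun I => F (I \ insert j S))
    (fun I => cechCongr L (sdiff_insert_eq I.2)) (fun I => cechCongr L (insert_sdiff_insert_eq I.2))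

/-- The differential of the mixed complex for `S` on the subsets not containing `j`. -/
def linkU (L : GradedCube x F) (j : Fin m) (S : Finset (Fin m)) :
    (∀ I : {I : Finset (Fin m) // j ∉ I}, F (I.1 \ S)) →ₗ[R]
      (∀ I : {I : Finset (Fin m) // j ∉ I}, F (I.1 \ S)) :=
  linkD _ fun _ _ h => mixRestrict L S h

/-- The differential of the localization at `x_j`, `j ∉ S`, of the mixed complex for `S` on the
subsets not containing `j`. -/
def linkV (L : GradedCube x F) (j : Fin m) (S : Finset (Fin m)) :
    (∀ I : {I : Finset (Fin m) // j ∉ I}, F (insert j I.1 \ S)) →ₗ[R]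
      (∀ I : {I : Finset (Fin m) // j ∉ I}, F (insert j I.1 \ S)) :=
  linkD _ fun _ _ h => mixRestrict L S (Finset.insert_subset_insert j h)

/-- The localization map from the complex of `linkU` to that of `linkV`. -/
def linkLoc (L : GradedCube x F) (j : Fin m) (S : Finset (Fin m)) :
    (∀ I : {I : Finset (Fin m) // j ∉ I}, F (I.1 \ S)) →ₗ[R]
      (∀ I : {I : Finset (Fin m) // j ∉ I}, F (insert j I.1 \ S)) :=
  LinearMap.piMap fun I => mixRestrict L S (Finset.subset_insert j I.1)

theorem linkLoc_linkU (L : GradedCube x F) (j : Fin m) (S : Finset (Fin m))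
    (u : ∀ I : {I : Finset (Fin m) // j ∉ I}, F (I.1 \ S)) :
    linkLoc L j S (linkU L j S u) = linkV L j S (linkLoc L j S u) :=
  linkD_map _ (fun I J h y => by rw [mixRestrict_trans, mixRestrict_trans]) u

theorem cechSplit_mixD (L : GradedCube x F) (j : Fin m) (S : Finset (Fin m))
    (c : ∀ I, F (I \ S)) :
    cechSplit R F j S (mixD L S c) =
      fibreD (linkU L j S) (linkV L j S) (linkLoc L j S) (cechSplit R F j S c) :=
  cubeSplit_cubeD (ρ := mixRestrict L S) (σ := fun _ _ h => mixRestrict L S h)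
    (σ' := fun _ _ h => mixRestrict L S (Finset.insert_subset_insert j h))
    (f := fun I => mixRestrict L S (Finset.subset_insert j I.1)) _ _
    (fun _ _ _ _ => by simp only [LinearEquiv.refl_apply])
    (fun _ _ _ _ => by simp only [LinearEquiv.refl_apply])
    (fun _ _ => by simp only [LinearEquiv.refl_apply]) c

theorem koszulSplit_mixD (L : GradedCube x F) (j : Fin m) (S : Finset (Fin m))
    (c : ∀ I, F (I \ insert j S)) :
    koszulSplit L j S (mixD L (insert j S) c) =
      fibreD (linkU L j S) (linkU L j S) (x j • LinearMap.id) (koszulSplit L j S c) := by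
  refine cubeSplit_cubeD (σ := fun _ _ h => mixRestrict L S h)
    (σ' := fun _ _ h => mixRestrict L S h) (f := fun I => x j • LinearMap.id) _ _ ?_ ?_ ?_ c
  · intro I J h y
    have hs : (J.1 \ I.1) ∩ insert j S = (J.1 \ I.1) ∩ S := by
      have := J.2
      ext l; simp only [Finset.mem_inter, Finset.mem_sdiff, Finset.mem_insert]; grind
    rw [mixRestrict_apply, mixRestrict_apply, map_smul, cechCongr_apply, cechCongr_apply,
      L.res_trans, L.res_trans, hs]
  · intro I J h y
    have hs : (insert j J.1 \ insert j I.1) ∩ insert j S = (J.1 \ I.1) ∩ S := by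
      have := J.2
      ext l; simp only [Finset.mem_inter, Finset.mem_sdiff, Finset.mem_insert]; grind
    rw [mixRestrict_apply, mixRestrict_apply, map_smul, cechCongr_apply, cechCongr_apply,
      L.res_trans, L.res_trans, hs]
  · intro I y
    have hs : (insert j I.1 \ I.1) ∩ insert j S = {j} := by
      have := I.2
      ext l; simp only [Finset.mem_inter, Finset.mem_sdiff, Finset.mem_insert,
        Finset.mem_singleton]; grind
    rw [mixRestrict_apply, map_smul, cechCongr_apply, cechCongr_apply, L.res_trans, hs,
      subProd_singleton]
    rfl

theorem cechSplit_bijective (j : Fin m) (S : Finset (Fin m)) :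
    Function.Bijective (cechSplit R F j S) := cubeSplit_bijective _ _

theorem koszulSplit_bijective (L : GradedCube x F) (j : Fin m) (S : Finset (Fin m)) :
    Function.Bijective (koszulSplit L j S) := cubeSplit_bijective _ _

theorem cechSplit_fst (c : ∀ I, F (I \ S))
    (I : {I : Finset (Fin m) // j ∉ I}) : (cechSplit R F j S c).1 I = c I := rfl

theorem cechSplit_snd (c : ∀ I, F (I \ S))
    (I : {I : Finset (Fin m) // j ∉ I}) : (cechSplit R F j S c).2 I =
      (-1 : ℤ) ^ (I.1.filter (· < j)).card • c (insert j I.1) := rfl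

theorem koszulSplit_fst (L : GradedCube x F) (c : ∀ I, F (I \ insert j S))
    (I : {I : Finset (Fin m) // j ∉ I}) : (koszulSplit L j S c).1 I =
      L.res (sdiff_insert_eq I.2).subset (c I) := rfl

theorem koszulSplit_snd (L : GradedCube x F) (c : ∀ I, F (I \ insert j S))
    (I : {I : Finset (Fin m) // j ∉ I}) : (koszulSplit L j S c).2 I =
      (-1 : ℤ) ^ (I.1.filter (· < j)).card •
        L.res (insert_sdiff_insert_eq I.2).subset (c (insert j I.1)) := rfl

theorem forall_finset_iff {p : Finset (Fin m) → Prop} :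
    (∀ I, p I) ↔ (∀ I : {I : Finset (Fin m) // j ∉ I}, p I.1) ∧
      ∀ I : {I : Finset (Fin m) // j ∉ I}, p (insert j I.1) := by
  refine ⟨fun h => ⟨fun I => h _, fun I => h _⟩, fun h I => ?_⟩
  by_cases hI : j ∈ I
  · obtain ⟨I, rfl⟩ := exists_eq_insert_of_mem hI
    exact h.2 I
  · exact h.1 ⟨I, hI⟩

theorem card_insert_ne_iff (I : {I : Finset (Fin m) // j ∉ I}) (i : ℤ) :
    ((insert j I.1).card : ℤ) ≠ i ↔ (I.1.card : ℤ) ≠ i - 1 := by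
  rw [Finset.card_insert_of_notMem I.2]
  push_cast
  omega

theorem cechSplit_mem_iff (L : GradedCube x F) (hj : j ∉ S) (i n : ℤ)
    (c : ∀ I, F (I \ S)) :
    cechSplit R F j S c ∈ fibreHomog (linkHomog L (fun I => I.1 \ S) fun I => (I.1 ∩ S).card)
      (linkHomog L (fun I => insert j I.1 \ S) fun I => (I.1 ∩ S).card) i n ↔
      c ∈ mixHomog L S i n := by
  refine Iff.trans ?_ (forall_finset_iff (j := j)).symm
  refine and_congr (forall_congr' fun I => Iff.rfl) (forall_congr' fun I => ?_)
  have hs : insert j I.1 ∩ S = I.1 ∩ S := Finset.insert_inter_of_notMem hj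
  rw [hs, card_insert_ne_iff]
  exact and_congr (imp_congr Iff.rfl (neg_one_pow_smul_eq_zero _)) (neg_one_pow_smul_mem _ _)

theorem koszulSplit_mem_iff (L : GradedCube x F) (hj : j ∉ S) (i n : ℤ)
    (c : ∀ I, F (I \ insert j S)) :
    koszulSplit L j S c ∈ fibreHomog (linkHomog L (fun I => I.1 \ S) fun I => (I.1 ∩ S).card)
      (fun i n => linkHomog L (fun I => I.1 \ S) (fun I => (I.1 ∩ S).card) i (n + 1)) i n ↔
      c ∈ mixHomog L (insert j S) i n := by
  refine Iff.trans ?_ (forall_finset_iff (j := j)).symm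
  refine and_congr (forall_congr' fun I => ?_) (forall_congr' fun I => ?_)
  · rw [Finset.inter_insert_of_notMem I.2]
    exact and_congr (imp_congr Iff.rfl
      (cechCongr L (sdiff_insert_eq I.2)).map_eq_zero_iff)
      (cechCongr_mem_iff L (sdiff_insert_eq I.2))
  · have hs : ((insert j I.1 ∩ insert j S).card : ℤ) = 1 + (I.1 ∩ S).card := by
      rw [← Finset.insert_inter_distrib, Finset.card_insert_of_notMem
        fun h => hj (Finset.mem_inter.1 h).2]
      push_cast; ring
    rw [hs, card_insert_ne_iff, ← add_assoc]
    exact and_congr (imp_congr Iff.rfl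
      ((neg_one_pow_smul_eq_zero _).trans
        (cechCongr L (insert_sdiff_insert_eq I.2)).map_eq_zero_iff))
      ((neg_one_pow_smul_mem _ _).trans
        (cechCongr_mem_iff L (insert_sdiff_insert_eq I.2)))

theorem smul_linkV_bijective (L : GradedCube x F) (hj : j ∉ S) :
    Function.Bijective fun v : ∀ I : {I : Finset (Fin m) // j ∉ I},
      F (insert j I.1 \ S) => x j • v := by
  have h (I : {I : Finset (Fin m) // j ∉ I}) :
      Function.Bijective fun y : F (insert j I.1 \ S) => x j • y := by
    have hsub : {j} ⊆ insert j I.1 \ S := by simp [hj]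
    simpa only [subProd_singleton] using L.smul_bijective hsub
  exact Function.Bijective.piMap h

theorem smul_mem_linkU (L : GradedCube x F) (i n : ℤ)
    (u : ∀ I : {I : Finset (Fin m) // j ∉ I}, F (I.1 \ S))
    (hu : u ∈ linkHomog L (fun I => I.1 \ S) (fun I => (I.1 ∩ S).card) i n) :
    x j • u ∈ linkHomog L (fun I => I.1 \ S) (fun I => (I.1 ∩ S).card) i (n + 1) := fun I => by
  refine ⟨fun h => by rw [Pi.smul_apply, (hu I).1 h, smul_zero], ?_⟩
  rw [add_right_comm]
  exact L.smul_mem j (hu I).2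

theorem smul_mem_linkV_iff (L : GradedCube x F) (hj : j ∉ S) (i n : ℤ)
    (v : ∀ I : {I : Finset (Fin m) // j ∉ I}, F (insert j I.1 \ S)) :
    x j • v ∈ linkHomog L (fun I => insert j I.1 \ S) (fun I => (I.1 ∩ S).card) i (n + 1) ↔
      v ∈ linkHomog L (fun I => insert j I.1 \ S) (fun I => (I.1 ∩ S).card) i n := by
  refine forall_congr' fun I => ?_
  have hsub : {j} ⊆ insert j I.1 \ S := by simp [hj]
  refine and_congr (imp_congr Iff.rfl ?_) ?_
  · have h := (L.smul_bijective hsub).1.eq_iff (a := v I) (b := 0)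
    simpa only [subProd_singleton, smul_zero] using! h
  · rw [add_right_comm]
    exact L.smul_mem_iff (hsub (Finset.mem_singleton_self j))

theorem linkLoc_apply (L : GradedCube x F) (hj : j ∉ S)
    (u : ∀ I : {I : Finset (Fin m) // j ∉ I}, F (I.1 \ S))
    (I : {I : Finset (Fin m) // j ∉ I}) :
    linkLoc L j S u I = L.res
      (Finset.sdiff_subset_sdiff (Finset.subset_insert j I.1) subset_rfl) (u I) := by
  have hs : (insert j I.1 \ I.1) ∩ S = ∅ := by
    ext l; simp only [Finset.mem_inter, Finset.mem_sdiff, Finset.mem_insert]; grind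
  change mixRestrict L S (Finset.subset_insert j I.1) (u I) = _
  rw [mixRestrict_apply, hs, subProd_empty, one_smul]

theorem linkLoc_mem (L : GradedCube x F) (hj : j ∉ S) (i n : ℤ)
    (u : ∀ I : {I : Finset (Fin m) // j ∉ I}, F (I.1 \ S))
    (hu : u ∈ linkHomog L (fun I => I.1 \ S) (fun I => (I.1 ∩ S).card) i n) :
    linkLoc L j S u ∈
      linkHomog L (fun I => insert j I.1 \ S) (fun I => (I.1 ∩ S).card) i n := fun I => by
  rw [linkLoc_apply L hj]
  exact ⟨fun h => by rw [(hu I).1 h, map_zero], L.res_mem _ (hu I).2⟩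

/-- Exactness of the mixed complexes on a diagonal passes from `S` to `S ∪ {j}`. -/
theorem mixD_exactOnDiagonal_insert (L : GradedCube x F) (hj : j ∉ S) {s : ℤ}
    (h : ExactOnDiagonal (mixD L S) (mixHomog L S) s) :
    ExactOnDiagonal (mixD L (insert j S)) (mixHomog L (insert j S)) s := by
  rw [ExactOnDiagonal.congr (koszulSplit_bijective L j S) (koszulSplit_mixD L j S)
    (koszulSplit_mem_iff L hj)]
  rw [ExactOnDiagonal.congr (cechSplit_bijective (R := R) (F := F) j S) (cechSplit_mixD L j S)
    (cechSplit_mem_iff L hj)] at h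
  exact h.fibre_smul (linkLoc_linkU L j S) (smul_linkV_bijective L hj) (smul_mem_linkU L)
    (smul_mem_linkV_iff L hj) (linkLoc_mem L hj)

/-- If the mixed complex for `S` is exact on the diagonal `k + 1`, then up to coboundaries its
cocycles on the diagonal `k` come from the mixed complex for `S ∪ {j}`, through the map that
divides the components at `I ∋ j` by `x_j`. -/
theorem exists_mixD_cocycle_insert (L : GradedCube x F) (hj : j ∉ S) {k : ℤ}
    (h : ExactOnDiagonal (mixD L S) (mixHomog L S) (k + 1)) {i : ℤ}
    {c : ∀ I, F (I \ S)} (hc : c ∈ mixHomog L S i (k - i)) (hdc : mixD L S c = 0) :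
    ∃ g ∈ mixHomog L (insert j S) i (k - i), mixD L (insert j S) g = 0 ∧
      ∃ b ∈ mixHomog L S (i - 1) (k - i), ∀ I, subProd x (I ∩ {j}) • (c + mixD L S b) I =
        L.res (Finset.sdiff_subset_sdiff subset_rfl (Finset.subset_insert j S)) (g I) := by
  rw [ExactOnDiagonal.congr (cechSplit_bijective (R := R) (F := F) j S) (cechSplit_mixD L j S)
    (cechSplit_mem_iff L hj)] at h
  have hmem := (cechSplit_mem_iff L hj i (k - i) c).2 hc
  have hd : fibreD (linkU L j S) (linkV L j S) (linkLoc L j S) (cechSplit R F j S c) = 0 := by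
    rw [← cechSplit_mixD, hdc, map_zero]
  obtain ⟨u, v, huv⟩ : ∃ u v, cechSplit R F j S c = (u, v) := ⟨_, _, rfl⟩
  rw [huv] at hmem hd
  obtain ⟨u', hmem, hd, b₀, hb₀, hu'⟩ := h.exists_fibre_smul (smul_linkV_bijective L hj)
    (smul_mem_linkU L) (smul_mem_linkV_iff L hj) hmem hd
  obtain ⟨g, hg⟩ : ∃ g, koszulSplit L j S g = (u, u') :=
    (koszulSplit_bijective L j S).2 _
  obtain ⟨b, hb⟩ : ∃ b, cechSplit R F j S b = (0, b₀) :=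
    (cechSplit_bijective (R := R) (F := F) j S).2 _
  have hsum : cechSplit R F j S (c + mixD L S b) =
      (u, v - linkV L j S b₀) := by
    rw [map_add, cechSplit_mixD, huv, hb, fibreD_apply, map_zero, map_zero, zero_sub,
      sub_eq_add_neg]
    exact Prod.ext (add_zero _) rfl
  refine ⟨g, (koszulSplit_mem_iff L hj _ _ _).1 (hg ▸ hmem), ?_, b,
    (cechSplit_mem_iff L hj _ _ _).1 (hb ▸ mem_fibreHomog.2 ⟨zero_mem _, hb₀⟩), ?_⟩
  · refine (koszulSplit_bijective L j S).1 ((koszulSplit_mixD L j S g).trans ?_)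
    rw [hg, hd]
    exact (map_zero (koszulSplit L j S)).symm
  · generalize c + mixD L S b = c' at hsum
    have hc' : ∀ I : {I : Finset (Fin m) // j ∉ I}, x j • (cechSplit R F j S c').2 I =
        linkLoc L j S (koszulSplit L j S g).2 I := fun I => by
      rw [hsum, hg, ← hu', Pi.smul_apply]
    rw [forall_finset_iff (j := j)]
    constructor
    · intro I
      have h1 : (cechSplit R F j S c').1 I = (koszulSplit L j S g).1 I := by rw [hsum, hg]
      rw [Finset.inter_singleton_of_notMem I.2, subProd_empty, one_smul]
      rwa [cechSplit_fst, koszulSplit_fst] at h1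
    · intro I
      have h1 := hc' I
      rw [linkLoc_apply L hj, cechSplit_snd, koszulSplit_snd, map_zsmul, L.res_trans,
        smul_comm] at h1
      rw [Finset.inter_singleton_of_mem (Finset.mem_insert_self j I.1), subProd_singleton]
      have h2 := congrArg ((-1 : ℤ) ^ (I.1.filter (· < j)).card • ·) h1
      simpa only [neg_one_pow_smul_smul] using h2

end Step

end Mixed

/-! ### The canonical morphism from a mixed complex to the Čech complex -/

noncomputable section MixToCech

variable {R : Type*} [CommRing R] {m : ℕ} {x : Fin m → R} {F : Finset (Fin m) → Type*}
  [∀ I, AddCommGroup (F I)] [∀ I, Module R (F I)]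

/-- The bihomogeneous cochains of the Čech complex. -/
def GradedCube.homog (L : GradedCube x F) (i n : ℤ) : AddSubgroup (∀ I, F I) where
  carrier := {c | ∀ I, ((I.card : ℤ) ≠ i → c I = 0) ∧ c I ∈ L.piece I n}
  zero_mem' := fun _ => ⟨fun _ => rfl, zero_mem _⟩
  add_mem' := fun ha hb I =>
    ⟨fun h => by rw [Pi.add_apply, (ha I).1 h, (hb I).1 h, add_zero], add_mem (ha I).2 (hb I).2⟩
  neg_mem' := fun ha I =>
    ⟨fun h => by rw [Pi.neg_apply, (ha I).1 h, neg_zero], neg_mem (ha I).2⟩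

/-- The canonical morphism from the mixed complex for `S` to the Čech complex; it divides the
component at `I` by `x_{I ∩ S}`. -/
def mixToCech (L : GradedCube x F) (S : Finset (Fin m)) : (∀ I, F (I \ S)) →ₗ[R] (∀ I, F I) :=
  LinearMap.piMap fun I =>
    (LinearEquiv.ofBijective (LinearMap.lsmul R (F I) (subProd x (I ∩ S)))
      (L.smul_bijective Finset.inter_subset_left)).symm.toLinearMap ∘ₗ L.res Finset.sdiff_subset

theorem subProd_smul_mixToCech (L : GradedCube x F) (S : Finset (Fin m)) (c : ∀ I, F (I \ S))
    (I : Finset (Fin m)) :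
    subProd x (I ∩ S) • mixToCech L S c I = L.res Finset.sdiff_subset (c I) :=
  LinearEquiv.apply_symm_apply (LinearEquiv.ofBijective (LinearMap.lsmul R (F I) _)
    (L.smul_bijective Finset.inter_subset_left)) _

theorem eq_mixToCech (L : GradedCube x F) {S : Finset (Fin m)} {c : ∀ I, F (I \ S)}
    {I : Finset (Fin m)} {y : F I}
    (h : subProd x (I ∩ S) • y = L.res Finset.sdiff_subset (c I)) : mixToCech L S c I = y :=
  (L.smul_bijective Finset.inter_subset_left).1
    ((subProd_smul_mixToCech L S c I).trans h.symm)

theorem mixToCech_mixD (L : GradedCube x F) (S : Finset (Fin m)) (c : ∀ I, F (I \ S)) :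
    mixToCech L S (mixD L S c) = cubeD F L.res (mixToCech L S c) := by
  funext J
  apply eq_mixToCech
  rw [cubeD_apply, mixD, cubeD_apply, map_sum, Finset.smul_sum]
  refine Finset.sum_congr rfl fun l hl => ?_
  have hdisj : Disjoint ((J \ J.erase l) ∩ S) (J.erase l ∩ S) :=
    Disjoint.mono Finset.inter_subset_left Finset.inter_subset_left Finset.sdiff_disjoint
  have hunion : J ∩ S = ((J \ J.erase l) ∩ S) ∪ (J.erase l ∩ S) := by
    rw [← Finset.union_inter_distrib_right, Finset.sdiff_union_of_subset (J.erase_subset l)]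
  rw [map_zsmul, smul_comm, mixRestrict_apply, map_smul, L.res_trans, hunion,
    subProd_union x hdisj, mul_smul, ← map_smul, subProd_smul_mixToCech, L.res_trans]

theorem mixToCech_empty (L : GradedCube x F) (c : ∀ I, F (I \ ∅)) (I : Finset (Fin m)) :
    mixToCech L ∅ c I = cechCongr L Finset.sdiff_empty (c I) := by
  apply eq_mixToCech
  rw [Finset.inter_empty, subProd_empty, one_smul]
  rfl

theorem mixToCech_empty_bijective (L : GradedCube x F) : Function.Bijective (mixToCech L ∅) := by
  have h : ⇑(mixToCech L ∅) =
      Pi.map fun I => ⇑(cechCongr L (Finset.sdiff_empty : I \ ∅ = I)) := by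
    funext c I
    exact mixToCech_empty L c I
  rw [h]
  exact Function.Bijective.piMap fun I => (cechCongr L _).bijective

theorem mixToCech_empty_mem_iff (L : GradedCube x F) (i n : ℤ) (c : ∀ I, F (I \ ∅)) :
    mixToCech L ∅ c ∈ L.homog i n ↔ c ∈ mixHomog L ∅ i n := by
  refine forall_congr' fun I => ?_
  rw [mixToCech_empty, Finset.inter_empty, Finset.card_empty, Nat.cast_zero, add_zero]
  exact and_congr (imp_congr Iff.rfl (LinearEquiv.map_eq_zero_iff _)) (cechCongr_mem_iff L _)

theorem mixToCech_mem_cubeDeg (L : GradedCube x F) {S : Finset (Fin m)} {i n : ℤ}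
    {c : ∀ I, F (I \ S)} (hc : c ∈ mixHomog L S i n) : mixToCech L S c ∈ cubeDeg R F i := by
  intro I hI
  apply eq_mixToCech
  rw [(hc I).1 hI, map_zero, smul_zero]

/-- If the Čech complex is exact on the diagonal `k + 1`, then up to coboundaries its cocycles on
the diagonal `k` come from every mixed complex. -/
theorem exists_mixD_cocycle (L : GradedCube x F) {k : ℤ}
    (h : ExactOnDiagonal (cubeD F L.res) L.homog (k + 1)) {i : ℤ} {c : ∀ I, F I}
    (hc : c ∈ L.homog i (k - i)) (hdc : cubeD F L.res c = 0) (S : Finset (Fin m)) :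
    ExactOnDiagonal (mixD L S) (mixHomog L S) (k + 1) ∧
      ∃ g ∈ mixHomog L S i (k - i), mixD L S g = 0 ∧
        ∃ b ∈ cubeDeg R F (i - 1), mixToCech L S g = c + cubeD F L.res b := by
  induction S using Finset.induction_on with
  | empty =>
    refine ⟨(ExactOnDiagonal.congr (mixToCech_empty_bijective L) (mixToCech_mixD L ∅)
      (mixToCech_empty_mem_iff L)).2 h, ?_⟩
    obtain ⟨g, rfl⟩ := (mixToCech_empty_bijective L).2 c
    refine ⟨g, (mixToCech_empty_mem_iff L _ _ _).1 hc, (mixToCech_empty_bijective L).1 ?_,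
      0, zero_mem _, by rw [map_zero, add_zero]⟩
    rw [mixToCech_mixD, hdc, map_zero]
  | insert j S hj ih =>
    obtain ⟨hS, g, hg, hdg, b, hb, hgb⟩ := ih
    refine ⟨mixD_exactOnDiagonal_insert L hj hS, ?_⟩
    obtain ⟨g', hg', hdg', b', hb', hgb'⟩ := exists_mixD_cocycle_insert L hj hS hg hdg
    refine ⟨g', hg', hdg', b + mixToCech L S b', add_mem hb (mixToCech_mem_cubeDeg L hb'), ?_⟩
    rw [map_add, ← mixToCech_mixD, ← add_assoc, ← hgb, ← map_add]
    funext I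
    apply eq_mixToCech
    have hdisj : Disjoint (I ∩ {j}) (I ∩ S) :=
      Disjoint.mono Finset.inter_subset_right Finset.inter_subset_right
        (Finset.disjoint_singleton_left.2 hj)
    have hprod : subProd x (I ∩ insert j S) = subProd x (I ∩ {j}) * subProd x (I ∩ S) := by
      rw [← subProd_union x hdisj, ← Finset.inter_union_distrib_left, ← Finset.insert_eq]
    rw [hprod, mul_smul, subProd_smul_mixToCech, ← map_smul, hgb', L.res_trans]

end MixToCech

/-! ### The canonical map of a graded ring -/

noncomputable section Surjectivity

variable {R : Type*} [CommRing R] {m : ℕ} {𝒢 : ℤ → AddSubgroup R} [GradedRing 𝒢] {x : Fin m → R}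

/-- The localizations of a graded ring at products of the forms `x_j` of degree one. -/
def cechGradedCube (hx : ∀ j, x j ∈ 𝒢 1) : GradedCube x (CechTerm x) where
  res _ _ h := (cechRestrict x h).toLinearMap
  res_self := cechRestrict_self x
  res_trans := cechRestrict_trans x
  piece := cechPiece 𝒢 x
  smul_bijective := smul_subProd_bijective x
  res_mem := cechRestrict_mem hx
  smul_mem j _ _ _ hy := smul_mem_cechPiece hx (hx j) hy
  smul_mem_iff {j I} hj n y := by
    have h := subProd_smul_mem_iff hx (Finset.singleton_subset_iff.2 hj) (n := n) (y := y)
    rwa [subProd_singleton, Finset.card_singleton, Nat.cast_one] at h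

/-- The vanishing of the graded pieces of the Čech cohomology on a diagonal, in terms of
homogeneous cochains. -/
theorem exactOnDiagonal_of_piece_eq_bot (hx : ∀ j, x j ∈ 𝒢 1) {s : ℤ}
    (hvan : ∀ i : ℤ, CechLocalCohomology.piece 𝒢 x i (s - i) = ⊥) :
    ExactOnDiagonal (cubeD (CechTerm x) (cechGradedCube hx).res) (cechGradedCube hx).homog s := by
  intro i c hc hdc
  have hcoc : c ∈ cubeDeg R (CechTerm x) i ⊓ LinearMap.ker (cechD x) :=
    ⟨fun I => (hc I).1, hdc⟩
  have hz : (Submodule.Quotient.mk ⟨c, hcoc⟩ : CechLocalCohomology x i) ∈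
      CechLocalCohomology.piece 𝒢 x i (s - i) := ⟨⟨c, hcoc⟩, fun I => (hc I).2, rfl⟩
  rw [hvan, AddSubgroup.mem_bot, Submodule.Quotient.mk_eq_zero] at hz
  obtain ⟨b, hb, hbc⟩ : ∃ b ∈ cubeDeg R (CechTerm x) (i - 1), cechD x b = c := hz
  -- The component of degree `s - i` of `b` has the same coboundary.
  refine ⟨fun I => cechProj hx I (s - i) (b I), fun I => ⟨fun hI => ?_, cechProj_mem hx I _ _⟩, ?_⟩
  · exact (congrArg (cechProj hx I (s - i)) (hb I hI)).trans (map_zero _)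
  · funext J
    rw [← cechProj_of_mem hx (hc J).2, ← hbc, cechD, cubeD_apply, cubeD_apply, map_sum]
    refine Finset.sum_congr rfl fun l _ => ?_
    rw [map_zsmul]
    congr 1
    exact (cechProj_restrict hx (J.erase_subset l) _ _).symm

theorem canonicalMapPiece_surjective (hx : ∀ j, x j ∈ 𝒢 1) {k : ℤ}
    (hvan : ∀ i : ℤ, CechLocalCohomology.piece 𝒢 x i (k + 1 - i) = ⊥) (i : ℤ) :
    Function.Surjective (canonicalMapPiece 𝒢 x i (k - i)) := by
  rintro ⟨_, ⟨c, hcoc⟩, hc, rfl⟩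
  obtain ⟨-, g, hg, hdg, b, hb, hgb⟩ := exists_mixD_cocycle (cechGradedCube hx)
    (exactOnDiagonal_of_piece_eq_bot hx hvan) (i := i) (c := c) (fun I => ⟨hcoc.1 I, hc I⟩)
    hcoc.2 Finset.univ
  -- The localizations in the mixed complex for all directions are copies of `R`.
  have huniv : ∀ I : Finset (Fin m), I \ Finset.univ = ∅ := fun I =>
    Finset.sdiff_eq_empty_iff_subset.2 (Finset.subset_univ I)
  have hinj := fun I => algebraMap_cechTerm_injective x (huniv I)
  choose g' hg' hgg' using fun I => exists_algebraMap_of_mem (huniv I) (hg I).2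
  have hdeg : g' ∈ cubeDeg R (KoszulTerm R m) i := fun I hI =>
    hinj I (by rw [hgg', (hg I).1 hI, map_zero])
  have hcocycle : koszulD x g' = 0 := by
    funext J
    refine hinj J ?_
    have h0 : algebraMap R (CechTerm x (J \ Finset.univ)) (koszulD x g' J) =
        mixD (cechGradedCube hx) Finset.univ g J := by
      rw [koszulD, mixD, cubeD_apply, cubeD_apply, map_sum]
      refine Finset.sum_congr rfl fun l _ => ?_
      rw [map_zsmul, mixRestrict_apply, ← hgg', Finset.inter_univ]
      congr 1
      change _ = subProd x (J \ J.erase l) •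
        cechRestrict x (Finset.sdiff_subset_sdiff (J.erase_subset l) subset_rfl)
          (algebraMap R _ (g' (J.erase l)))
      rw [AlgHom.commutes, Algebra.smul_def, ← map_mul]
      rfl
    rw [h0, hdg]
    exact (map_zero _).symm
  have hcan : koszulToCech x g' = c + cechD x b := by
    refine Eq.trans ?_ hgb
    funext I
    rw [koszulToCech_apply]
    symm
    apply eq_mixToCech
    rw [Finset.inter_univ, ← hgg', Algebra.smul_def, algebraMap_mul_cechFrac]
    exact (AlgHom.commutes (cechRestrict x Finset.sdiff_subset) _).symm
  refine ⟨⟨Submodule.Quotient.mk ⟨g', hdeg, hcocycle⟩, ⟨g', hdeg, hcocycle⟩, fun I => ?_, rfl⟩, ?_⟩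
  · have h := hg' I
    rwa [Finset.inter_univ] at h
  · refine Subtype.ext ((Submodule.Quotient.eq _).2 ⟨b, hb, ?_⟩)
    change cechD x b = koszulToCech x g' - c
    rw [hcan, add_sub_cancel_left]

end Surjectivity

/-! ### The grading of the form ring -/

noncomputable section FormRingGrading

variable {A : Type*} [CommRing A] (𝔮 : Ideal A)

namespace FormRing

theorem mem_piece_natCast_iff {n : ℕ} {g : FormRing 𝔮} :
    g ∈ piece 𝔮 n ↔ g = DirectSum.of (FormComponent 𝔮) n (g n) := by
  constructor
  · intro h
    refine DFinsupp.ext fun l => ?_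
    by_cases hl : l = n
    · subst hl
      exact (DirectSum.of_eq_same l _).symm
    · rw [h l (by exact_mod_cast hl), DirectSum.of_eq_of_ne _ _ _ hl]
  · intro h l hl
    rw [h, DirectSum.of_eq_of_ne _ _ _ (by exact_mod_cast hl)]

theorem of_mem_piece {n : ℕ} (u : FormComponent 𝔮 n) :
    DirectSum.of (FormComponent 𝔮) n u ∈ piece 𝔮 n :=
  fun l hl => DirectSum.of_eq_of_ne _ _ _ (by exact_mod_cast hl)

theorem eq_zero_of_mem_piece_of_neg {n : ℤ} (hn : n < 0) {g : FormRing 𝔮} (hg : g ∈ piece 𝔮 n) :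
    g = 0 :=
  DFinsupp.ext fun l => hg l (by omega)

instance gradedRing : GradedRing (piece 𝔮) where
  one_mem := of_mem_piece 𝔮 (n := 0) _
  mul_mem := by
    intro i j a b ha hb
    rcases lt_or_ge i 0 with hi | hi
    · rw [eq_zero_of_mem_piece_of_neg 𝔮 hi ha, zero_mul]
      exact zero_mem _
    rcases lt_or_ge j 0 with hj | hj
    · rw [eq_zero_of_mem_piece_of_neg 𝔮 hj hb, mul_zero]
      exact zero_mem _
    lift i to ℕ using hi
    lift j to ℕ using hj
    rw [(mem_piece_natCast_iff 𝔮).1 ha, (mem_piece_natCast_iff 𝔮).1 hb, DirectSum.of_mul_of]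
    exact_mod_cast of_mem_piece 𝔮 _
  toDecomposition := DirectSum.Decomposition.ofAddHom (piece 𝔮)
    (DirectSum.toAddMonoid fun n : ℕ => (DirectSum.of (fun n : ℤ => piece 𝔮 n) n).comp
      ((DirectSum.of (FormComponent 𝔮) n).codRestrict (piece 𝔮 n) (of_mem_piece 𝔮)))
    (by
      ext n u : 2
      simp)
    (by
      ext n ⟨g, hg⟩ : 2
      rcases lt_or_ge n 0 with hn | hn
      · obtain rfl := eq_zero_of_mem_piece_of_neg 𝔮 hn hg
        exact (map_zero _).trans (map_zero _).symm
      · lift n to ℕ using hn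
        have h := (mem_piece_natCast_iff 𝔮).1 hg
        generalize g n = u at h
        subst h
        simp)

end FormRing

end FormRingGrading

theorem proposition3p2 {A : Type*} [CommRing A] [IsNoetherianRing A] (𝔮 : Ideal A)
    {m : ℕ} (x : Fin m → FormRing 𝔮) (hx_deg : ∀ j, x j ∈ FormRing.piece 𝔮 1)
    (hx_span : Ideal.span (Set.range x) = FormRing.initialIdeal 𝔮) (k : ℤ)
    (hvan : ∀ i : ℤ, CechLocalCohomology.piece (FormRing.piece 𝔮) x i (k + 1 - i) = ⊥) :
    ∀ i : ℤ, Function.Surjective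
      (canonicalMapPiece (FormRing.piece 𝔮) x i (k - i)) :=
  canonicalMapPiece_surjective hx_deg hvan
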